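/- Notation: $\mathbb D$ is the open unit disc in $\mathbb C$, $\mathbb T=\partial\mathbb D$, $\mathcal L_{\mathbb T}$ is the Lebesgue (arc length) measure on $\mathbb T$ (of total mass $2\pi$), and $z\bullet w=\sum_{j=1}^n z_jw_j$ for $z,w\in\mathbb C^n$. A domain $D\subset\mathbb C^n$ is a convex tube if $D=\Omega+i\mathbb R^n$ for some convex domain $\Omega\subset\mathbb R^n$; it is taut if every sequence of holomorphic maps $\mathbb D\to D$ has a subsequence that either converges locally uniformly on $\mathbb D$ to a holomorphic map $\mathbb D\to D$ or is compactly divergent. For a holomorphic map $\varphi:\mathbb D\to\mathbb C^n$, $\varphi^*(\lambda)=\lim_{r\to1^-}\varphi(r\lambda)$ is the radial limit at $\lambda\in\mathbb T$ (when it exists), and a tuple $\mu=(\mu_1,\dots,\mu_n)$ of finite real Borel measures on $\mathbb T$ is the boundary measure of $\varphi$ if $$\varphi_j(\lambda)=\frac1{2\pi}\int_{\mathbb T}\frac{\zeta+\lambda}{\zeta-\lambda}\,d\mu_j(\zeta)+i\alpha_j,\qquad \lambda\in\mathbb D,\ j=1,\dots,n,$$ for some $\alpha_1,\dots,\alpha_n\in\mathbb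 R$. For a bounded Borel function $v:\mathbb T\to\mathbb C^n$ and a tuple $\nu$ of real measures, $v\bullet d\nu=\sum_j v_j\,d\nu_j$. A measure is called negative if it is real and takes only values $\le 0$. Lemma. Let $D\subset\mathbb C^n$ be a taut convex tube, let $\varphi:\mathbb D\to D$ be a holomorphic map with boundary measure $\mu$, and let $h(\lambda)=\bar a\lambda^2+b\lambda+a$ for some $a\in\mathbb C^n$, $b\in\mathbb R^n$, with $h\not\equiv0$. Then (m) the measure $\bar\lambda h(\lambda)\bullet(\operatorname{Re}z\,d\mathcal L_{\mathbb T}(\lambda)-d\mu(\lambda))$ on $\mathbb T$ is negative for every $z\in D$ if and only if the following two conditions hold: (i) for $\mathcal L_{\mathbb T}$-almost every $\lambda\in\mathbb T$, the radial limit $\varphi^*(\lambda)$ exists and $\operatorname{Re}\big[\bar\lambda h(\lambda)\bullet(z-\varphi^*(\lambda))\big]<0$ for all $z\in D$; (ii) $\operatorname{Re}\Big[h(\lambda)\bullet\dfrac{\varphi(0)-\varphi(\lambda)}{\lambda}\Big]<0$ for every $\lambda\in\mathbb D\setminus\{0\}$. -/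

import Mathlib

open MeasureTheory Set Filter Topology
open scoped ComplexConjugate

namespace ConvexTube

/-- `D ⊆ ℂⁿ` is a convex tube: `D = Ω + iℝⁿ` for a (nonempty, open) convex domain `Ω ⊆ ℝⁿ`. -/
def IsConvexTube {n : ℕ} (D : Set (Fin n → ℂ)) : Prop :=
  ∃ Ω : Set (Fin n → ℝ), IsOpen Ω ∧ Convex ℝ Ω ∧ Ω.Nonempty ∧
    D = {z | (fun j => (z j).re) ∈ Ω}

/-- `f` restricts to a holomorphic map from the open unit disc into `D`
(the values of `f` outside the disc are irrelevant). -/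
def IsHolDisc {n : ℕ} (f : ℂ → Fin n → ℂ) (D : Set (Fin n → ℂ)) : Prop :=
  DifferentiableOn ℂ f (Metric.ball 0 1) ∧ MapsTo f (Metric.ball 0 1) D

/-- Tautness of a domain `D`: the family of holomorphic maps from the unit disc to `D` is normal,
that is, every sequence of such maps has a subsequence which either converges locally uniformly to
a holomorphic map from the disc into `D`, or is compactly divergent. -/
def IsTaut {n : ℕ} (D : Set (Fin n → ℂ)) : Prop :=
  ∀ f : ℕ → ℂ → Fin n → ℂ, (∀ k, IsHolDisc (f k) D) →
    ∃ s : ℕ → ℕ, StrictMono s ∧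
      ((∃ g : ℂ → Fin n → ℂ, IsHolDisc g D ∧
          TendstoLocallyUniformlyOn (fun k => f (s k)) g atTop (Metric.ball 0 1)) ∨
        (∀ K : Set ℂ, K ⊆ Metric.ball 0 1 → IsCompact K →
          ∀ L : Set (Fin n → ℂ), L ⊆ D → IsCompact L →
            ∀ᶠ k in atTop, Disjoint (f (s k) '' K) L))

/-- The unit circle `𝕋`, with its Borel σ-algebra. -/
abbrev UnitCircle : Type := Metric.sphere (0 : ℂ) 1

/-- The point `exp (iθ)` of the unit circle. -/
noncomputable def expMap (θ : ℝ) : UnitCircle :=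
  ⟨Complex.exp (θ * Complex.I), by simp [Complex.norm_exp_ofReal_mul_I]⟩

/-- The Lebesgue (arc length) measure on the unit circle, of total mass `2π`. -/
noncomputable def lebT : Measure UnitCircle :=
  (volume.restrict (Ioc 0 (2 * Real.pi))).map expMap

instance instIsFiniteMeasureLebT : IsFiniteMeasure lebT := by
  unfold lebT
  infer_instance

/-- `μ = (μ₁, …, μₙ)` (real measures on the circle) is the boundary measure of `φ`:
`φⱼ(λ) = (1/2π) ∫ (ζ+λ)/(ζ-λ) dμⱼ(ζ) + iαⱼ` on the unit disc for some real `αⱼ`. -/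
def IsBoundaryMeasure {n : ℕ} (φ : ℂ → Fin n → ℂ) (μ : Fin n → SignedMeasure UnitCircle) : Prop :=
  ∀ j, ∃ α : ℝ, ∀ l ∈ Metric.ball (0 : ℂ) 1,
    φ l j = 1 / (2 * (Real.pi : ℂ)) * (∫ᵛ ζ, ((ζ : ℂ) + l) / ((ζ : ℂ) - l) ∂<•(μ j))
      + Complex.I * (α : ℂ)

/-- The complex measure `v • dμ = ∑ⱼ vⱼ dμⱼ`, for a tuple `μ` of real measures and a (bounded
Borel) function `v : 𝕋 → ℂⁿ`. -/
noncomputable def dotMeasure {n : ℕ} (v : UnitCircle → Fin n → ℂ)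
    (μ : Fin n → SignedMeasure UnitCircle) : ComplexMeasure UnitCircle :=
  ∑ j, VectorMeasure.withDensity (μ j) (fun ζ => v ζ j) (ContinuousLinearMap.lsmul ℝ ℝ).flip

/-- The complex measure `ν` is real and negative (i.e. nonpositive). -/
def IsNegativeMeasure (ν : ComplexMeasure UnitCircle) : Prop :=
  ∀ E : Set UnitCircle, MeasurableSet E → (ν E).im = 0 ∧ (ν E).re ≤ 0

/-- `w` is the radial limit `φ*(ζ) = lim_{r → 1⁻} φ(rζ)`. -/
def IsRadialLimit {n : ℕ} (φ : ℂ → Fin n → ℂ) (ζ : UnitCircle) (w : Fin n → ℂ) : Prop :=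
  Tendsto (fun r : ℝ => φ ((r : ℂ) * (ζ : ℂ))) (𝓝[<] 1) (𝓝 w)

end ConvexTube

namespace ConvexTube

/-! On the circle, the factor `λ̄ h(λ)` is the real vector with entries `p_j = b_j + 2 Re (ā_j λ)`.
Write `ν_z` for the measure `∑ p_j (Re z_j dℒ - dμ_j)`. Two observations carry the proof. The first
is that the Poisson integral of `ν_z` at `z = φ(0)` is exactly `2π Re [h(l) • (φ(0) - φ(l))/l]`
(`two_pi_mul_re_dotProduct_eq_pairing`). So (ii) says that this Poisson integral is strictly
negative off the origin. The second is that replacing `φ(0)` by `z` adds only the continuous density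
`∑ (Re z_j - Re φ_j(0)) p_j`, so the singular part of `ν_z` does not depend on `z`
(`pairing_sub_pairing`). From (m), the Poisson integrals of all `ν_z` are nonpositive, and radial
limits give (i) and (ii) with `≤`. Strictness comes from the openness of the base of the tube
(`IsConvexTube.exists_sum_pos`). In (i), `z` can be moved in the direction `p(ζ)`, which is nonzero
for almost every `ζ`. In (ii), equality at one point would force `ν_{φ(0)} = 0`, and then the same
perturbation gives `h = 0`. Conversely, (ii) gives `ν_{φ(0)} ≤ 0`, since Poisson integrals determine
the order of measures (`le_of_integral_poissonK_le`). By Fatou's theorem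
(`ae_tendsto_integral_poissonK`) the density of `ν_{φ(0)}` is read off from the radial limits of
`φ`, and (i) makes the density of `ν_z` negative. The singular part is that of `ν_{φ(0)}`, hence
also nonpositive. Radial limits of `φ` exist because each component is built from Herglotz
transforms of positive measures (`ae_exists_tendsto_herglotz`). -/

/-! ### The circle, arc length, and differentiation of measures. -/

instance : CompactSpace UnitCircle := isCompact_iff_compactSpace.1 (isCompact_sphere _ _)

lemma UnitCircle.norm_coe (ζ : UnitCircle) : ‖(ζ : ℂ)‖ = 1 := by simp

lemma UnitCircle.conj_mul_self (ζ : UnitCircle) : conj (ζ : ℂ) * ζ = 1 := by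
  rw [mul_comm, Complex.mul_conj, Complex.normSq_eq_norm_sq, ζ.norm_coe]; simp

lemma UnitCircle.ne_zero (ζ : UnitCircle) : (ζ : ℂ) ≠ 0 := by
  rw [← norm_pos_iff, ζ.norm_coe]; exact one_pos

lemma UnitCircle.inv_eq_conj (ζ : UnitCircle) : (ζ : ℂ)⁻¹ = conj (ζ : ℂ) :=
  (eq_inv_of_mul_eq_one_left ζ.conj_mul_self).symm

lemma continuous_expMap : Continuous expMap := by
  unfold expMap; fun_prop

lemma expMap_periodic : Function.Periodic expMap (2 * Real.pi) := by
  intro θ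
  apply Subtype.ext
  have := Complex.exp_periodic (θ * Complex.I)
  simpa [expMap, add_mul] using this

lemma expMap_surjective (ζ : UnitCircle) : ∃ θ : ℝ, expMap θ = ζ := by
  refine ⟨Complex.arg ζ, Subtype.ext ?_⟩
  have := Complex.norm_mul_exp_arg_mul_I (ζ : ℂ)
  rw [ζ.norm_coe] at this
  simpa [expMap] using this

/-- Arc length on the circle can be computed over any period. -/
lemma lebT_eq_map (a : ℝ) :
    lebT = (volume.restrict (Ioc a (a + 2 * Real.pi))).map expMap := by
  have : Fact (0 < 2 * Real.pi) := ⟨Real.two_pi_pos⟩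
  have hg : Continuous (expMap_periodic.lift) :=
    continuous_coinduced_dom.2 continuous_expMap
  have key (t : ℝ) : (volume.restrict (Ioc t (t + 2 * Real.pi))).map expMap =
      (volume : Measure (AddCircle (2 * Real.pi))).map expMap_periodic.lift := by
    rw [← (AddCircle.measurePreserving_mk (2 * Real.pi) t).map_eq,
      Measure.map_map hg.measurable (AddCircle.measurePreserving_mk (2 * Real.pi) t).measurable]
    rfl
  rw [key, ← key 0, lebT, zero_add]

lemma integral_lebT {E : Type*} [NormedAddCommGroup E] [NormedSpace ℝ E]
    (f : UnitCircle → E) (hf : Continuous f) :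
    ∫ ζ, f ζ ∂lebT = ∫ θ in (0 : ℝ)..2 * Real.pi, f (expMap θ) := by
  rw [lebT, integral_map continuous_expMap.aemeasurable hf.aestronglyMeasurable_of_compactSpace,
    intervalIntegral.integral_of_le Real.two_pi_pos.le]

lemma circleAverage_eq_integral_lebT {E : Type*} [NormedAddCommGroup E] [NormedSpace ℝ E]
    (f : ℂ → E) (hf : Continuous fun ζ : UnitCircle => f ζ) :
    Real.circleAverage f 0 1 = (2 * Real.pi)⁻¹ • ∫ ζ : UnitCircle, f ζ ∂lebT := by
  rw [integral_lebT _ hf, Real.circleAverage]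
  simp [circleMap, expMap]

lemma dist_expMap (θ t : ℝ) : dist (expMap (θ + t)) (expMap θ) = 2 * |Real.sin (t / 2)| := by
  rw [Subtype.dist_eq, dist_eq_norm]
  have h : ((expMap (θ + t) : UnitCircle) : ℂ) - expMap θ =
      Complex.exp (θ * Complex.I) * (Complex.exp (Complex.I * t) - 1) := by
    rw [mul_sub, ← Complex.exp_add, mul_one]
    simp only [expMap, Complex.ofReal_add]
    ring_nf
  rw [h, norm_mul, Complex.norm_exp_ofReal_mul_I, one_mul, Complex.norm_exp_I_mul_ofReal_sub_one]
  simp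

/-- Centring the period at `θ` keeps `(x - θ) / 2` within `[-π/2, π/2]`, where the sine is
comparable to its argument. -/
lemma lebT_closedBall_expMap (θ δ : ℝ) :
    lebT (Metric.closedBall (expMap θ) δ) =
      volume ({x | 2 * |Real.sin ((x - θ) / 2)| ≤ δ} ∩ Ioc (θ - Real.pi) (θ + Real.pi)) := by
  rw [lebT_eq_map (θ - Real.pi), Measure.map_apply continuous_expMap.measurable
    Metric.isClosed_closedBall.measurableSet, Measure.restrict_apply
    (Metric.isClosed_closedBall.preimage continuous_expMap).measurableSet]
  congr 2
  · ext x
    have := dist_expMap θ (x - θ)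
    rw [add_sub_cancel] at this
    simp [this]
  · congr 1; ring

/-- A chord is no longer than its arc; `δ < π` keeps the arc inside one period. -/
lemma le_lebT_closedBall (ζ : UnitCircle) {δ : ℝ} (hδ' : δ < Real.pi) :
    ENNReal.ofReal (2 * δ) ≤ lebT (Metric.closedBall ζ δ) := by
  obtain ⟨θ, rfl⟩ := expMap_surjective ζ
  rw [lebT_closedBall_expMap, show 2 * δ = (θ + δ) - (θ - δ) by ring, ← Real.volume_Icc]
  refine measure_mono fun x hx => ⟨?_, ?_, ?_⟩
  · have h1 : |(x - θ) / 2| ≤ δ / 2 := by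
      rw [abs_le]; constructor <;> linarith [hx.1, hx.2]
    have h2 := Real.abs_sin_le_abs (x := (x - θ) / 2)
    simp only [mem_ofPred_eq]
    linarith
  · linarith [hx.1]
  · linarith [hx.2]

/-- Jordan's inequality: a chord is at least `2/π` times its arc. -/
lemma lebT_closedBall_le (ζ : UnitCircle) (δ : ℝ) :
    lebT (Metric.closedBall ζ δ) ≤ ENNReal.ofReal (Real.pi * δ) := by
  obtain ⟨θ, rfl⟩ := expMap_surjective ζ
  rw [lebT_closedBall_expMap, show Real.pi * δ = (θ + Real.pi * δ / 2) - (θ - Real.pi * δ / 2) by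
    ring, ← Real.volume_Icc]
  refine measure_mono fun x hx => ?_
  have hπ := Real.pi_pos
  have h1 : |(x - θ) / 2| ≤ Real.pi / 2 := by
    rw [abs_le]; constructor <;> linarith [hx.2.1, hx.2.2]
  have h2 := Real.mul_abs_le_abs_sin h1
  have h3 : 2 * (2 / Real.pi * |(x - θ) / 2|) ≤ δ := by
    have := hx.1
    simp only [mem_ofPred_eq] at this
    linarith
  have h4 : |x - θ| ≤ Real.pi * δ / 2 := by
    rw [abs_div, abs_two] at h3
    have : 2 * (2 / Real.pi * (|x - θ| / 2)) = 2 * |x - θ| / Real.pi := by ring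
    rw [this, div_le_iff₀ hπ] at h3
    linarith
  rw [abs_le] at h4
  constructor <;> linarith [h4.1, h4.2]

/-- Doubling makes closed balls a Vitali family, so that measures can be differentiated along them.
-/
instance : IsUnifLocDoublingMeasure lebT where
  exists_measure_closedBall_le_mul'' := by
    refine ⟨4, ?_⟩
    filter_upwards [Ioo_mem_nhdsGT Real.pi_pos] with δ hδ ζ
    refine (lebT_closedBall_le ζ _).trans ?_
    calc ENNReal.ofReal (Real.pi * (2 * δ)) ≤ ENNReal.ofReal (4 * (2 * δ)) :=
          ENNReal.ofReal_le_ofReal (by nlinarith [Real.pi_le_four, hδ.1])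
      _ = 4 * ENNReal.ofReal (2 * δ) := by
          rw [ENNReal.ofReal_mul (by norm_num)]; norm_num
      _ ≤ _ := by
          push_cast
          gcongr
          exact le_lebT_closedBall ζ hδ.2

instance : NullSingletonClass lebT where
  measure_singleton ζ := by
    have h : Tendsto (fun δ : ℝ => ENNReal.ofReal (Real.pi * δ)) (𝓝[>] 0) (𝓝 0) := by
      have : Continuous fun δ : ℝ => ENNReal.ofReal (Real.pi * δ) :=
        ENNReal.continuous_ofReal.comp (continuous_const.mul continuous_id)
      simpa using (this.tendsto 0).mono_left nhdsWithin_le_nhds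
    refine le_antisymm (ge_of_tendsto h ?_) zero_le
    filter_upwards [self_mem_nhdsWithin] with δ hδ
    refine (measure_mono ?_).trans (lebT_closedBall_le ζ δ)
    simpa using (mem_Ioi.1 hδ).le

lemma ae_tendsto_measure_closedBall_div (ρ : Measure UnitCircle) [IsFiniteMeasure ρ] :
    ∀ᵐ ζ ∂lebT, Tendsto (fun δ => ρ (Metric.closedBall ζ δ) / lebT (Metric.closedBall ζ δ))
      (𝓝[>] 0) (𝓝 (ρ.rnDeriv lebT ζ)) := by
  filter_upwards [(IsUnifLocDoublingMeasure.vitaliFamily lebT 1).ae_tendsto_rnDeriv ρ] with ζ hζ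
  refine hζ.comp (IsUnifLocDoublingMeasure.tendsto_closedBall_filterAt lebT _ _ tendsto_id ?_)
  filter_upwards [self_mem_nhdsWithin] with δ hδ
  simpa using (mem_Ioi.1 hδ).le

/-! ### The Poisson kernel and Poisson's formula. -/

lemma UnitCircle.sub_ne_zero (ζ : UnitCircle) {l : ℂ} (hl : ‖l‖ < 1) : (ζ : ℂ) - l ≠ 0 := by
  intro h
  have := ζ.norm_coe
  rw [sub_eq_zero.1 h] at this
  exact hl.ne this

/-- The Poisson kernel of the unit disc. -/
noncomputable def poissonK (l : ℂ) (ζ : UnitCircle) : ℝ := (((ζ : ℂ) + l) / ((ζ : ℂ) - l)).re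

lemma continuous_herglotz_kernel {l : ℂ} (hl : ‖l‖ < 1) :
    Continuous fun ζ : UnitCircle => ((ζ : ℂ) + l) / ((ζ : ℂ) - l) :=
  Continuous.div (by fun_prop) (by fun_prop) fun ζ => ζ.sub_ne_zero hl

lemma continuous_poissonK {l : ℂ} (hl : ‖l‖ < 1) : Continuous (poissonK l) :=
  Complex.continuous_re.comp (continuous_herglotz_kernel hl)

lemma poissonK_eq (l : ℂ) (ζ : UnitCircle) :
    poissonK l ζ = (1 - ‖l‖ ^ 2) / ‖(ζ : ℂ) - l‖ ^ 2 := by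
  have h := congrFun (poissonKernel_eq_re_herglotzRieszKernel (c := 0) (w := l)) ζ
  simp only [poissonKernel_def, Function.comp_apply, herglotzRieszKernel_def, sub_zero,
    ζ.norm_coe, one_pow] at h
  exact h.symm

lemma poissonK_pos {l : ℂ} (hl : ‖l‖ < 1) (ζ : UnitCircle) : 0 < poissonK l ζ := by
  rw [poissonK_eq]
  have := norm_pos_iff.2 (ζ.sub_ne_zero hl)
  have : ‖l‖ ^ 2 < 1 := by nlinarith [norm_nonneg l]
  apply div_pos <;> [linarith; positivity]

lemma norm_real_mul_lt_one {r : ℝ} (hr : r ∈ Ioo (0 : ℝ) 1) (ζ : UnitCircle) :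
    ‖(r : ℂ) * ζ‖ < 1 := by
  rw [norm_mul, ζ.norm_coe, mul_one, Complex.norm_real, Real.norm_of_nonneg hr.1.le]
  exact hr.2

/-- In this form the kernel depends on `w` and `ζ` only through their distance. This yields both its
symmetry and the fact that its superlevel sets are balls. -/
lemma poissonK_radial (r : ℝ) (ζ w : UnitCircle) :
    poissonK (r * ζ) w = (1 - r ^ 2) / ((1 - r) ^ 2 + r * dist w ζ ^ 2) := by
  rw [poissonK_eq, Subtype.dist_eq, dist_eq_norm]
  have h1 := ζ.norm_coe
  have h2 := w.norm_coe
  congr 1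
  · rw [norm_mul, h1, mul_one, Complex.norm_real, Real.norm_eq_abs, sq_abs]
  · have e1 : (ζ : ℂ).re ^ 2 + (ζ : ℂ).im ^ 2 = 1 := by
      have := Complex.normSq_eq_norm_sq (ζ : ℂ)
      rw [h1, Complex.normSq_apply] at this
      linarith
    have e2 : (w : ℂ).re ^ 2 + (w : ℂ).im ^ 2 = 1 := by
      have := Complex.normSq_eq_norm_sq (w : ℂ)
      rw [h2, Complex.normSq_apply] at this
      linarith
    rw [← Complex.normSq_eq_norm_sq, ← Complex.normSq_eq_norm_sq, Complex.normSq_apply,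
      Complex.normSq_apply]
    simp only [Complex.sub_re, Complex.sub_im, Complex.mul_re, Complex.mul_im, Complex.ofReal_re,
      Complex.ofReal_im]
    linear_combination (r ^ 2 - r) * e1 + (1 - r) * e2

lemma poissonK_comm (r : ℝ) (ζ w : UnitCircle) :
    poissonK (r * ζ) w = poissonK (r * w) ζ := by
  rw [poissonK_radial, poissonK_radial, dist_comm]

/-- Poisson's formula for functions holomorphic on a neighbourhood of the closed disc. -/
lemma integral_poissonK_smul {f : ℂ → ℂ} (hf : DiffContOnCl ℂ f (Metric.ball 0 1)) {l : ℂ}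
    (hl : ‖l‖ < 1) : ∫ ζ : UnitCircle, (poissonK l ζ : ℂ) * f ζ ∂lebT = 2 * Real.pi * f l := by
  have hl' : l ∈ Metric.ball (0 : ℂ) 1 := by simpa using hl
  have h := hf.circleAverage_re_herglotzRieszKernel_smul hl'
  have hc : Continuous fun ζ : UnitCircle => f ζ := by
    have h1 := hf.continuousOn
    rw [closure_ball _ one_ne_zero] at h1
    exact h1.comp_continuous continuous_subtype_val fun ζ => Metric.sphere_subset_closedBall ζ.2
  have e : (fun ζ : UnitCircle => ((Complex.re ∘ herglotzRieszKernel 0 l) • f) ζ) =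
      fun ζ : UnitCircle => (poissonK l ζ : ℂ) * f ζ := by
    ext ζ
    simp [poissonK, herglotzRieszKernel_def]
  rw [circleAverage_eq_integral_lebT _ (by
    rw [e]; exact (Complex.continuous_ofReal.comp (continuous_poissonK hl)).mul hc), e] at h
  rw [← h, Complex.real_smul]
  push_cast
  field_simp

lemma integral_poissonK_mul_re {f : ℂ → ℂ} (hf : DiffContOnCl ℂ f (Metric.ball 0 1)) {l : ℂ}
    (hl : ‖l‖ < 1) :
    ∫ ζ : UnitCircle, poissonK l ζ * (f ζ).re ∂lebT = 2 * Real.pi * (f l).re := by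
  have h := integral_poissonK_smul hf hl
  have hc : Continuous fun ζ : UnitCircle => f ζ := by
    have h1 := hf.continuousOn
    rw [closure_ball _ one_ne_zero] at h1
    exact h1.comp_continuous continuous_subtype_val fun ζ => Metric.sphere_subset_closedBall ζ.2
  have hi : Integrable (fun ζ : UnitCircle => (poissonK l ζ : ℂ) * f ζ) lebT :=
    ((Complex.continuous_ofReal.comp (continuous_poissonK hl)).mul hc).integrable_of_hasCompactSupport
      (HasCompactSupport.of_compactSpace _)
  have h2 := integral_re hi
  rw [h] at h2
  simpa [Complex.mul_re] using h2

lemma integral_poissonK_lebT {l : ℂ} (hl : ‖l‖ < 1) :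
    ∫ ζ, poissonK l ζ ∂lebT = 2 * Real.pi := by
  simpa using integral_poissonK_mul_re (f := fun _ => 1) diffContOnCl_const hl

lemma _root_.Continuous.integrable_unitCircle {E : Type*} [NormedAddCommGroup E]
    {f : UnitCircle → E} (hf : Continuous f) (ρ : Measure UnitCircle) [IsFiniteMeasure ρ] :
    Integrable f ρ :=
  hf.integrable_of_hasCompactSupport (HasCompactSupport.of_compactSpace _)

/-! ### Fatou's theorem on radial limits of Poisson integrals. -/

/-- A layer-cake comparison: measures comparable on all small balls around a point give
comparable integrals to functions whose superlevel sets are balls around that point. -/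
lemma lintegral_closedBall_le_of_superlevel {X : Type*} [PseudoMetricSpace X] [MeasurableSpace X]
    [OpensMeasurableSpace X] {ρ m : Measure X} {x : X} {R : ℝ} (hR : 0 ≤ R)
    (hle : ∀ s, 0 ≤ s → s ≤ R → ρ (Metric.closedBall x s) ≤ m (Metric.closedBall x s))
    {K : X → ℝ} (hK : Measurable K) (hK0 : ∀ y, 0 ≤ K y)
    (hlev : ∀ t, 0 < t → {y | t ≤ K y} = ∅ ∨ ∃ s, 0 ≤ s ∧ {y | t ≤ K y} = Metric.closedBall x s) :
    ∫⁻ y in Metric.closedBall x R, ENNReal.ofReal (K y) ∂ρ ≤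
      ∫⁻ y in Metric.closedBall x R, ENNReal.ofReal (K y) ∂m := by
  rw [lintegral_eq_lintegral_meas_le _ (Eventually.of_forall hK0) hK.aemeasurable,
    lintegral_eq_lintegral_meas_le _ (Eventually.of_forall hK0) hK.aemeasurable]
  refine setLIntegral_mono' measurableSet_Ioi fun t ht => ?_
  rw [Measure.restrict_apply (measurableSet_le measurable_const hK),
    Measure.restrict_apply (measurableSet_le measurable_const hK)]
  rcases hlev t ht with h | ⟨s, hs, h⟩
  · simp [h]
  · have : Metric.closedBall x s ∩ Metric.closedBall x R = Metric.closedBall x (min s R) := by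
      ext y; simp
    rw [h, this]
    exact hle _ (le_min hs hR) (min_le_right _ _)

lemma poissonK_superlevel {r : ℝ} (hr : r ∈ Ioo (0 : ℝ) 1) (ζ : UnitCircle) (t : ℝ) (ht : 0 < t) :
    {w | t ≤ poissonK (r * ζ) w} = ∅ ∨
      ∃ s, 0 ≤ s ∧ {w | t ≤ poissonK (r * ζ) w} = Metric.closedBall ζ s := by
  have hden (w : UnitCircle) : 0 < (1 - r) ^ 2 + r * dist w ζ ^ 2 := by
    have := hr.1
    have : 0 < 1 - r := by linarith [hr.2]
    positivity
  have key (w : UnitCircle) : t ≤ poissonK (r * ζ) w ↔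
      dist w ζ ^ 2 ≤ ((1 - r ^ 2) / t - (1 - r) ^ 2) / r := by
    rw [poissonK_radial, le_div_iff₀ (hden w), le_div_iff₀ hr.1, le_sub_iff_add_le (b := (1 - r) ^ 2),
      le_div_iff₀ ht]
    constructor <;> intro h <;> linarith
  rcases lt_or_ge (((1 - r ^ 2) / t - (1 - r) ^ 2) / r) 0 with h | h
  · left
    ext w
    simp only [mem_ofPred_eq, mem_empty_iff_false, iff_false, key, not_le]
    exact h.trans_le (sq_nonneg _)
  · right
    refine ⟨√(((1 - r ^ 2) / t - (1 - r) ^ 2) / r), Real.sqrt_nonneg _, ?_⟩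
    ext w
    rw [mem_ofPred_eq, key, Metric.mem_closedBall, Real.le_sqrt dist_nonneg h]

/-- Constants on both sides let this one lemma serve for the upper and the lower estimate in Fatou's
theorem. -/
lemma setIntegral_poissonK_le {ρ m : Measure UnitCircle} [IsFiniteMeasure ρ] [IsFiniteMeasure m]
    {ζ : UnitCircle} {R a b : ℝ} (hR : 0 ≤ R) (ha : 0 ≤ a) (hb : 0 ≤ b)
    (hle : ∀ s, 0 ≤ s → s ≤ R → ENNReal.ofReal a * ρ (Metric.closedBall ζ s) ≤
      ENNReal.ofReal b * m (Metric.closedBall ζ s)) {r : ℝ} (hr : r ∈ Ioo (0 : ℝ) 1) :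
    a * ∫ w in Metric.closedBall ζ R, poissonK (r * ζ) w ∂ρ ≤
      b * ∫ w in Metric.closedBall ζ R, poissonK (r * ζ) w ∂m := by
  have hl := norm_real_mul_lt_one hr ζ
  have hc := continuous_poissonK hl
  have h0 (w : UnitCircle) : 0 ≤ poissonK (r * ζ) w := (poissonK_pos hl w).le
  have h := lintegral_closedBall_le_of_superlevel (ρ := ENNReal.ofReal a • ρ)
    (m := ENNReal.ofReal b • m) (x := ζ) hR (by simpa using hle) hc.measurable h0
    (poissonK_superlevel hr ζ)
  have e (ν : Measure UnitCircle) [IsFiniteMeasure ν] :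
      ∫⁻ w in Metric.closedBall ζ R, ENNReal.ofReal (poissonK (r * ζ) w) ∂ν =
        ENNReal.ofReal (∫ w in Metric.closedBall ζ R, poissonK (r * ζ) w ∂ν) :=
    (ofReal_integral_eq_lintegral_ofReal (hc.integrable_unitCircle _)
      (Eventually.of_forall h0)).symm
  have hnn (ν : Measure UnitCircle) : 0 ≤ ∫ w in Metric.closedBall ζ R, poissonK (r * ζ) w ∂ν :=
    integral_nonneg h0
  rw [Measure.restrict_smul, Measure.restrict_smul, lintegral_smul_measure, lintegral_smul_measure,
    e, e, smul_eq_mul, smul_eq_mul, ← ENNReal.ofReal_mul ha, ← ENNReal.ofReal_mul hb,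
    ENNReal.ofReal_le_ofReal_iff (mul_nonneg hb (hnn _))] at h
  exact h

/-- Outside the ball the denominator of the kernel is at least `r R²`, so the tail vanishes as `r →
1`. -/
lemma setIntegral_poissonK_compl_le (ρ : Measure UnitCircle) [IsFiniteMeasure ρ]
    (ζ : UnitCircle) {R : ℝ} (hR : 0 < R) {r : ℝ} (hr : r ∈ Ioo (0 : ℝ) 1) :
    ∫ w in (Metric.closedBall ζ R)ᶜ, poissonK (r * ζ) w ∂ρ ≤
      ρ.real univ * ((1 - r ^ 2) / (r * R ^ 2)) := by
  have hl := norm_real_mul_lt_one hr ζ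
  have hr2 : 0 ≤ 1 - r ^ 2 := by nlinarith [hr.1, hr.2]
  have hr0 := hr.1
  have hq : 0 ≤ (1 - r ^ 2) / (r * R ^ 2) := by positivity
  calc ∫ w in (Metric.closedBall ζ R)ᶜ, poissonK (r * ζ) w ∂ρ
      ≤ ∫ w in (Metric.closedBall ζ R)ᶜ, (1 - r ^ 2) / (r * R ^ 2) ∂ρ := by
        refine setIntegral_mono_on ((continuous_poissonK hl).integrable_unitCircle _).integrableOn
          (integrable_const _) Metric.isClosed_closedBall.measurableSet.compl fun w hw => ?_
        have hw' : R < dist w ζ := by simpa using hw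
        rw [poissonK_radial]
        gcongr
        have : R ^ 2 ≤ dist w ζ ^ 2 := by gcongr
        nlinarith [sq_nonneg (1 - r)]
    _ ≤ _ := by
        rw [setIntegral_const, smul_eq_mul]
        exact mul_le_mul_of_nonneg_right (measureReal_mono (subset_univ _)) hq

/-- Fatou's theorem, pointwise: the Poisson integral of a finite measure converges radially to its
symmetric derivative, wherever the latter exists. -/
lemma tendsto_integral_poissonK {ρ : Measure UnitCircle} [IsFiniteMeasure ρ] {ζ : UnitCircle}
    {c : ℝ} (hc : 0 ≤ c)
    (hd : ∀ ε > 0, ∃ R > 0, ∀ s, 0 < s → s ≤ R →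
      ρ (Metric.closedBall ζ s) ≤ ENNReal.ofReal (c + ε) * lebT (Metric.closedBall ζ s) ∧
      ENNReal.ofReal (c - ε) * lebT (Metric.closedBall ζ s) ≤ ρ (Metric.closedBall ζ s)) :
    Tendsto (fun r : ℝ => ∫ w, poissonK (r * ζ) w ∂ρ) (𝓝[<] 1) (𝓝 (2 * Real.pi * c)) := by
  have hπ := Real.pi_pos
  rw [Metric.tendsto_nhds]
  intro η hη
  -- Half of `η` pays for the error in the density, the other half for the tail outside the ball.
  obtain ⟨ε, hε, hεη⟩ : ∃ ε > 0, 2 * Real.pi * ε = η / 2 :=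
    ⟨η / (4 * Real.pi), by positivity, by field_simp; norm_num⟩
  obtain ⟨R, hR, hd⟩ := hd ε hε
  -- The layer-cake comparison also needs radius `0`, which `hd` does not cover.
  have hsing : ρ {ζ} = 0 := by
    have h : Tendsto (fun s : ℝ => ENNReal.ofReal (c + ε) * ENNReal.ofReal (Real.pi * s)) (𝓝[>] 0)
        (𝓝 (ENNReal.ofReal (c + ε) * 0)) := by
      have h1 : Continuous fun s : ℝ => ENNReal.ofReal (Real.pi * s) :=
        ENNReal.continuous_ofReal.comp (continuous_const.mul continuous_id)
      have h2 := (h1.tendsto 0).mono_left (nhdsWithin_le_nhds (s := Ioi 0))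
      rw [mul_zero, ENNReal.ofReal_zero] at h2
      exact ENNReal.Tendsto.const_mul h2 (Or.inr ENNReal.ofReal_ne_top)
    rw [mul_zero] at h
    refine le_antisymm (ge_of_tendsto h ?_) zero_le
    filter_upwards [Ioo_mem_nhdsGT hR] with s hs
    calc ρ {ζ} ≤ ρ (Metric.closedBall ζ s) := measure_mono (by simpa using hs.1.le)
      _ ≤ _ := (hd s hs.1 hs.2.le).1
      _ ≤ _ := by gcongr; exact lebT_closedBall_le ζ s
  have hup : ∀ s, 0 ≤ s → s ≤ R → ENNReal.ofReal 1 * ρ (Metric.closedBall ζ s) ≤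
      ENNReal.ofReal (c + ε) * lebT (Metric.closedBall ζ s) := by
    intro s hs hsR
    rcases hs.eq_or_lt with rfl | hs
    · simp [hsing]
    · simpa using (hd s hs hsR).1
  -- The truncation at `0` is needed because `c - ε` may be negative.
  have hlow : ∀ s, 0 ≤ s → s ≤ R → ENNReal.ofReal (max (c - ε) 0) * lebT (Metric.closedBall ζ s) ≤
      ENNReal.ofReal 1 * ρ (Metric.closedBall ζ s) := by
    intro s hs hsR
    rcases hs.eq_or_lt with rfl | hs
    · simp
    · simpa using (hd s hs hsR).2
  have htail (M : ℝ) : Tendsto (fun r : ℝ => M * ((1 - r ^ 2) / (r * R ^ 2))) (𝓝[<] 1) (𝓝 0) := by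
    have : ContinuousAt (fun r : ℝ => M * ((1 - r ^ 2) / (r * R ^ 2))) 1 := by
      refine continuousAt_const.mul (ContinuousAt.div (by fun_prop) (by fun_prop) ?_)
      positivity
    simpa using this.tendsto.mono_left (nhdsWithin_le_nhds (s := Iio 1))
  filter_upwards [Ioo_mem_nhdsLT one_pos, (htail (ρ.real univ)).eventually_lt_const (half_pos hη),
    (htail (c * lebT.real univ)).eventually_lt_const (half_pos hη)] with r hr ht1 ht2
  have hl := norm_real_mul_lt_one hr ζ
  have hB : MeasurableSet (Metric.closedBall ζ R) := Metric.isClosed_closedBall.measurableSet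
  have hnn (ν : Measure UnitCircle) : 0 ≤ ∫ w, poissonK (r * ζ) w ∂ν :=
    integral_nonneg fun w => (poissonK_pos hl w).le
  have s1 := integral_add_compl hB ((continuous_poissonK hl).integrable_unitCircle ρ)
  have s2 := integral_add_compl hB ((continuous_poissonK hl).integrable_unitCircle lebT)
  rw [integral_poissonK_lebT hl] at s2
  have t1 := setIntegral_poissonK_compl_le ρ ζ hR hr
  have t2 := setIntegral_poissonK_compl_le lebT ζ hR hr
  have u1 := setIntegral_poissonK_le hR.le zero_le_one (by positivity) hup hr
  have u2 := setIntegral_poissonK_le hR.le (le_max_right _ _) zero_le_one hlow hr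
  have p1 := hnn (ρ.restrict (Metric.closedBall ζ R))
  have p2 := hnn (ρ.restrict (Metric.closedBall ζ R)ᶜ)
  have p3 := hnn (lebT.restrict (Metric.closedBall ζ R))
  have p4 := hnn (lebT.restrict (Metric.closedBall ζ R)ᶜ)
  have hcε : 0 ≤ c + ε := by positivity
  rw [Real.dist_eq, abs_lt]
  constructor
  · have k1 := mul_le_mul_of_nonneg_left t2 hc
    rcases le_total (c - ε) 0 with h | h
    · nlinarith
    · rw [max_eq_left h] at u2
      nlinarith
  · nlinarith

lemma tendsto_integral_poissonK_of_tendsto {ρ : Measure UnitCircle} [IsFiniteMeasure ρ]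
    {ζ : UnitCircle} {c : ENNReal} (hc : c ≠ ⊤)
    (h : Tendsto (fun s => ρ (Metric.closedBall ζ s) / lebT (Metric.closedBall ζ s))
      (𝓝[>] 0) (𝓝 c)) :
    Tendsto (fun r : ℝ => ∫ w, poissonK (r * ζ) w ∂ρ) (𝓝[<] 1) (𝓝 (2 * Real.pi * c.toReal)) := by
  refine tendsto_integral_poissonK ENNReal.toReal_nonneg fun ε hε => ?_
  have h1 : c < ENNReal.ofReal (c.toReal + ε) := by
    rw [ENNReal.lt_ofReal_iff_toReal_lt hc]; linarith
  have e1 : ∀ᶠ s in 𝓝[>] (0 : ℝ), ENNReal.ofReal (c.toReal - ε) ≤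
      ρ (Metric.closedBall ζ s) / lebT (Metric.closedBall ζ s) := by
    rcases le_or_gt (c.toReal - ε) 0 with h0 | h0
    · simp [ENNReal.ofReal_of_nonpos h0]
    · have h2 : ENNReal.ofReal (c.toReal - ε) < c := by
        rw [ENNReal.ofReal_lt_iff_lt_toReal h0.le hc]; linarith
      filter_upwards [h.eventually_const_lt h2] with s hs using hs.le
  obtain ⟨R, hR, hRs⟩ := mem_nhdsGT_iff_exists_Ioc_subset.1
    (((h.eventually_lt_const h1).and e1).and (Ioo_mem_nhdsGT Real.pi_pos))
  refine ⟨R, hR, fun s hs hsR => ?_⟩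
  obtain ⟨⟨k1, k2⟩, k3⟩ := hRs ⟨hs, hsR⟩
  have hpos : lebT (Metric.closedBall ζ s) ≠ 0 := by
    have := le_lebT_closedBall ζ k3.2
    refine (lt_of_lt_of_le ?_ this).ne'
    simpa using hs
  have hfin : lebT (Metric.closedBall ζ s) ≠ ⊤ := measure_ne_top _ _
  exact ⟨(ENNReal.div_le_iff hpos hfin).1 k1.le, (ENNReal.le_div_iff_mul_le (Or.inl hpos)
    (Or.inl hfin)).1 k2⟩

/-- **Fatou's theorem**: the Poisson integral of a finite measure converges radially almost
everywhere to the density of its absolutely continuous part. -/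
lemma ae_tendsto_integral_poissonK (ρ : Measure UnitCircle) [IsFiniteMeasure ρ] :
    ∀ᵐ ζ : UnitCircle ∂lebT, Tendsto (fun r : ℝ => ∫ w, poissonK (r * ζ) w ∂ρ) (𝓝[<] 1)
      (𝓝 (2 * Real.pi * (ρ.rnDeriv lebT ζ).toReal)) := by
  filter_upwards [ae_tendsto_measure_closedBall_div ρ, Measure.rnDeriv_lt_top ρ lebT] with ζ h1 h2
  exact tendsto_integral_poissonK_of_tendsto h2.ne h1

/-- The Poisson integral of a continuous function converges radially to that function. -/
lemma tendsto_integral_poissonK_mul {f : UnitCircle → ℝ} (hf : Continuous f) (hf0 : ∀ w, 0 ≤ f w)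
    (ζ : UnitCircle) :
    Tendsto (fun r : ℝ => ∫ w, poissonK (r * ζ) w * f w ∂lebT) (𝓝[<] 1)
      (𝓝 (2 * Real.pi * f ζ)) := by
  have hfi := hf.integrable_unitCircle lebT
  have : IsFiniteMeasure (lebT.withDensity fun w => ENNReal.ofReal (f w)) :=
    isFiniteMeasure_withDensity_ofReal hfi.2
  have key := tendsto_integral_poissonK (ρ := lebT.withDensity fun w => ENNReal.ofReal (f w))
    (ζ := ζ) (hf0 ζ) fun ε hε => by
      obtain ⟨R, hR, hRs⟩ := Metric.continuous_iff.1 hf ζ ε hε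
      refine ⟨R / 2, half_pos hR, fun s hs hsR => ?_⟩
      have hB : MeasurableSet (Metric.closedBall ζ s) := Metric.isClosed_closedBall.measurableSet
      have hclose (w : UnitCircle) (hw : w ∈ Metric.closedBall ζ s) : |f w - f ζ| < ε :=
        hRs w ((Metric.mem_closedBall.1 hw).trans_lt (by linarith))
      rw [withDensity_apply _ hB, ← setLIntegral_const, ← setLIntegral_const]
      constructor <;> refine setLIntegral_mono' hB fun w hw => ENNReal.ofReal_le_ofReal ?_ <;>
        linarith [abs_lt.1 (hclose w hw)]
  refine key.congr fun r => ?_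
  rw [integral_withDensity_eq_integral_toReal_smul (by fun_prop) (by simp)]
  refine integral_congr_ae (Eventually.of_forall fun w => ?_)
  simp [ENNReal.toReal_ofReal (hf0 w), mul_comm]

/-! ### Herglotz representation and radial limits of holomorphic functions. -/

/-- Up to a constant, a holomorphic function with nonnegative real part has as real part the
Poisson integral of a finite measure. -/
lemma exists_re_eq_integral_poissonK {G : ℂ → ℂ} (hG : DifferentiableOn ℂ G (Metric.ball 0 1))
    (hre : ∀ l ∈ Metric.ball (0 : ℂ) 1, 0 ≤ (G l).re) (h0 : 0 < (G 0).re) :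
    ∃ ρ : Measure UnitCircle, IsFiniteMeasure ρ ∧ ∃ c : ℝ, ∀ l ∈ Metric.ball (0 : ℂ) 1,
      (G l).re = c * ∫ w, poissonK l w ∂ρ := by
  have hπ := Real.pi_pos
  set c := (G 0).re with hc
  let r : ℕ → ℝ := fun k => 1 - 1 / ((k : ℝ) + 2)
  have hr (k : ℕ) : r k ∈ Ioo (0 : ℝ) 1 := by
    have h2 : (0 : ℝ) < (k : ℝ) + 2 := by positivity
    have : 1 / ((k : ℝ) + 2) < 1 := by
      rw [div_lt_one h2]; linarith [(Nat.cast_nonneg k : (0 : ℝ) ≤ k)]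
    have : 0 < 1 / ((k : ℝ) + 2) := by positivity
    constructor <;> simp only [r] <;> linarith
  have hrlim : Tendsto r atTop (𝓝 1) := by
    have h := tendsto_one_div_add_atTop_nhds_zero_nat (𝕜 := ℝ)
    have h' := ((tendsto_add_atTop_iff_nat 1).2 h).const_sub 1
    rw [sub_zero] at h'
    refine h'.congr fun k => ?_
    simp only [r]; push_cast; ring_nf
  have hmem (k : ℕ) {l : ℂ} (hl : ‖l‖ ≤ 1) : (r k : ℂ) * l ∈ Metric.ball (0 : ℂ) 1 := by
    rw [mem_ball_zero_iff, norm_mul, Complex.norm_real, Real.norm_of_nonneg (hr k).1.le]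
    nlinarith [(hr k).1, (hr k).2, norm_nonneg l]
  have hdiff (k : ℕ) : DiffContOnCl ℂ (fun l => G (r k * l)) (Metric.ball 0 1) := by
    refine DifferentiableOn.diffContOnCl ?_
    rw [closure_ball _ one_ne_zero]
    exact hG.comp (by fun_prop) fun l hl => hmem k (by simpa using hl)
  have hcont (k : ℕ) : Continuous fun ζ : UnitCircle => (G (r k * ζ)).re := by
    refine Complex.continuous_re.comp (hG.continuousOn.comp_continuous (by fun_prop) fun ζ => ?_)
    exact hmem k ζ.norm_coe.le
  -- By the mean value property this factor normalises the dilated real parts to probability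
  -- densities.
  let f : ℕ → UnitCircle → ℝ := fun k ζ => (2 * Real.pi * c)⁻¹ * (G (r k * ζ)).re
  have hfc (k : ℕ) : Continuous (f k) := (hcont k).const_mul _
  have hf0 (k : ℕ) (ζ : UnitCircle) : 0 ≤ f k ζ :=
    mul_nonneg (by positivity) (hre _ (hmem k ζ.norm_coe.le))
  have hint (k : ℕ) {l : ℂ} (hl : ‖l‖ < 1) :
      ∫ w, poissonK l w * f k w ∂lebT = c⁻¹ * (G (r k * l)).re := by
    have h := integral_poissonK_mul_re (hdiff k) hl
    have e : (fun w => poissonK l w * f k w) =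
        fun w : UnitCircle => (2 * Real.pi * c)⁻¹ * (poissonK l w * (G (r k * w)).re) := by
      ext w; simp only [f]; ring
    rw [e, integral_const_mul, h]
    field_simp
  let m : ℕ → Measure UnitCircle := fun k => lebT.withDensity fun w => ENNReal.ofReal (f k w)
  have hm (k : ℕ) : IsProbabilityMeasure (m k) := by
    constructor
    have h := hint k (l := 0) (by simp)
    have e : (fun w => poissonK 0 w * f k w) = f k := by
      ext w
      rw [poissonK]
      simp [w.ne_zero]
    rw [e, mul_zero, inv_mul_cancel₀ h0.ne'] at h
    rw [withDensity_apply _ MeasurableSet.univ, Measure.restrict_univ,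
      ← ofReal_integral_eq_lintegral_ofReal ((hfc k).integrable_unitCircle _)
        (Eventually.of_forall (hf0 k)), h, ENNReal.ofReal_one]
  let q : ℕ → ProbabilityMeasure UnitCircle := fun k => ⟨m k, hm k⟩
  -- Weak compactness of the probability measures on the circle; a limit along an ultrafilter
  -- replaces a convergent subsequence.
  obtain ⟨ρ, -, hρ⟩ := isCompact_univ.ultrafilter_le_nhds
    ((Ultrafilter.of (atTop : Filter ℕ)).map q) (by simp)
  have hρ' : Tendsto q (Ultrafilter.of (atTop : Filter ℕ)) (𝓝 ρ) := hρ
  rw [ProbabilityMeasure.tendsto_iff_forall_integral_tendsto] at hρ'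
  refine ⟨ρ, inferInstance, c, fun l hl => ?_⟩
  have hl' : ‖l‖ < 1 := by simpa using hl
  have h1 := hρ' (BoundedContinuousFunction.mkOfCompact ⟨_, continuous_poissonK hl'⟩)
  have e (k : ℕ) : ∫ w, poissonK l w ∂(m k) = c⁻¹ * (G (r k * l)).re := by
    have hmeas : Measurable fun w => ENNReal.ofReal (f k w) := (hfc k).measurable.ennreal_ofReal
    rw [← hint k hl', integral_withDensity_eq_integral_toReal_smul hmeas (by simp)]
    refine integral_congr_ae (Eventually.of_forall fun w => ?_)
    simp [ENNReal.toReal_ofReal (hf0 k w), mul_comm]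
  have h2 : Tendsto (fun k => c⁻¹ * (G (r k * l)).re) atTop (𝓝 (c⁻¹ * (G l).re)) := by
    have hGl : ContinuousAt G l := (hG.differentiableAt (Metric.isOpen_ball.mem_nhds hl)).continuousAt
    have h3 : Tendsto (fun k => (r k : ℂ) * l) atTop (𝓝 l) := by
      simpa using ((Complex.continuous_ofReal.tendsto 1).comp hrlim).mul_const l
    exact ((Complex.continuous_re.tendsto _).comp (hGl.tendsto.comp h3)).const_mul _
  have h3 := tendsto_nhds_unique (h1.congr fun k => e k) (h2.mono_left (Ultrafilter.of_le _))
  have h4 : ∫ w, poissonK l w ∂(ρ : Measure UnitCircle) = c⁻¹ * (G l).re := h3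
  rw [h4]
  field_simp

/-- Adding `2` makes the real part positive, so it becomes a multiple of a Poisson integral and
Fatou's theorem applies. -/
lemma ae_exists_tendsto_re {G : ℂ → ℂ} (hG : DifferentiableOn ℂ G (Metric.ball 0 1))
    (hb : ∀ l ∈ Metric.ball (0 : ℂ) 1, ‖G l‖ ≤ 1) :
    ∀ᵐ ζ : UnitCircle ∂lebT, ∃ x : ℝ, Tendsto (fun r : ℝ => (G (r * ζ)).re) (𝓝[<] 1) (𝓝 x) := by
  have hre (l : ℂ) (hl : l ∈ Metric.ball (0 : ℂ) 1) : 1 ≤ (G l + 2).re := by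
    have := (abs_le.1 ((Complex.abs_re_le_norm (G l)).trans (hb l hl))).1
    simp only [Complex.add_re, Complex.re_ofNat]
    linarith
  obtain ⟨ρ, hρ, c, hc⟩ := exists_re_eq_integral_poissonK (G := fun l => G l + 2) (by fun_prop)
    (fun l hl => zero_le_one.trans (hre l hl)) (one_pos.trans_le (hre 0 (by simp)))
  filter_upwards [ae_tendsto_integral_poissonK ρ] with ζ hζ
  refine ⟨_, ((hζ.const_mul c).sub_const 2).congr' ?_⟩
  filter_upwards [Ioo_mem_nhdsLT one_pos] with r hr
  rw [← hc _ (by simpa using norm_real_mul_lt_one hr ζ)]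
  simp

/-- Bounded holomorphic functions have radial limits almost everywhere. -/
lemma ae_exists_tendsto_of_bounded {G : ℂ → ℂ} (hG : DifferentiableOn ℂ G (Metric.ball 0 1))
    (hb : ∀ l ∈ Metric.ball (0 : ℂ) 1, ‖G l‖ ≤ 1) :
    ∀ᵐ ζ : UnitCircle ∂lebT, ∃ w : ℂ, Tendsto (fun r : ℝ => G (r * ζ)) (𝓝[<] 1) (𝓝 w) := by
  filter_upwards [ae_exists_tendsto_re hG hb,
    ae_exists_tendsto_re (G := fun l => -Complex.I * G l) (by fun_prop) (by simpa using hb)]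
    with ζ h1 h2
  obtain ⟨x, hx⟩ := h1
  obtain ⟨y, hy⟩ := h2
  refine ⟨x + y * Complex.I, Tendsto.congr (fun r => ?_)
    (((Complex.continuous_ofReal.tendsto x).comp hx).add
      (((Complex.continuous_ofReal.tendsto y).comp hy).mul_const Complex.I))⟩
  simp

/-- A path whose exponential converges to a nonzero limit converges. -/
lemma exists_tendsto_of_tendsto_exp {u : ℝ → ℂ} {c : ℂ} (hc : c ≠ 0)
    (hu : ContinuousOn u (Ioo 0 1))
    (h : Tendsto (fun r => Complex.exp (u r)) (𝓝[<] 1) (𝓝 c)) :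
    ∃ w, Tendsto u (𝓝[<] 1) (𝓝 w) := by
  have h1 : Tendsto (fun r => Complex.exp (u r) / c) (𝓝[<] 1) (𝓝 1) := by
    simpa [hc] using h.div_const c
  have hslit : ∀ᶠ r in 𝓝[<] (1 : ℝ), Complex.exp (u r) / c ∈ Complex.slitPlane :=
    h1.eventually (Complex.isOpen_slitPlane.mem_nhds Complex.one_mem_slitPlane)
  obtain ⟨s, hs, hsub⟩ := mem_nhdsLT_iff_exists_Ioo_subset.1
    (hslit.and (Ioo_mem_nhdsLT (zero_lt_one (α := ℝ))))
  have hs1 : s < 1 := hs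
  -- The gap between `u` and a continuous logarithm of its exponential takes values in `2πiℤ`, so
  -- near `1` it is continuous and hence constant.
  let v : ℝ → ℂ := fun r => u r - Complex.log c - Complex.log (Complex.exp (u r) / c)
  have hvc : ContinuousOn v (Ioo s 1) := by
    have hu' : ContinuousOn u (Ioo s 1) := hu.mono fun r hr => (hsub hr).2
    refine (hu'.sub continuousOn_const).sub (ContinuousOn.clog ?_ fun r hr => (hsub hr).1)
    exact (Complex.continuous_exp.comp_continuousOn hu').div_const c
  have hv (r : ℝ) : ∃ n : ℤ, v r = n * (2 * Real.pi * Complex.I) := by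
    rw [← Complex.exp_eq_one_iff]
    simp only [v]
    rw [Complex.exp_sub, Complex.exp_sub, Complex.exp_log hc,
      Complex.exp_log (div_ne_zero (Complex.exp_ne_zero _) hc)]
    exact div_self (div_ne_zero (Complex.exp_ne_zero _) hc)
  choose n hn using hv
  have hπ : (2 * Real.pi * Complex.I : ℂ) ≠ 0 := Complex.two_pi_I_ne_zero
  have hnc : ContinuousOn (fun r => (n r : ℝ)) (Ioo s 1) := by
    have : ContinuousOn (fun r => (v r / (2 * Real.pi * Complex.I)).re) (Ioo s 1) :=
      Complex.continuous_re.comp_continuousOn (hvc.div_const _)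
    refine this.congr fun r _ => ?_
    simp only [hn r, mul_div_cancel_right₀ _ hπ, Complex.intCast_re]
  have hnc' : ContinuousOn n (Ioo s 1) := by
    rwa [Int.isClosedEmbedding_coe_real.isInducing.continuousOn_iff]
  have hr0 : (s + 1) / 2 ∈ Ioo s 1 := by constructor <;> linarith
  have hconst (r : ℝ) (hr : r ∈ Ioo s 1) : n r = n ((s + 1) / 2) :=
    isPreconnected_Ioo.constant hnc' hr hr0
  refine ⟨Complex.log c + n ((s + 1) / 2) * (2 * Real.pi * Complex.I), ?_⟩
  have hlog : Tendsto (fun r => Complex.log (Complex.exp (u r) / c)) (𝓝[<] 1) (𝓝 0) := by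
    simpa using h1.clog Complex.one_mem_slitPlane
  have := hlog.const_add (Complex.log c + n ((s + 1) / 2) * (2 * Real.pi * Complex.I))
  rw [add_zero] at this
  refine this.congr' ?_
  filter_upwards [Ioo_mem_nhdsLT hs1] with r hr
  rw [← hconst r hr, ← hn r]
  simp only [v]
  ring

/-- The Herglotz transform of a measure on the circle. -/
noncomputable def herglotz (ρ : Measure UnitCircle) (l : ℂ) : ℂ :=
  ∫ ζ : UnitCircle, ((ζ : ℂ) + l) / ((ζ : ℂ) - l) ∂ρ

lemma re_herglotz (ρ : Measure UnitCircle) [IsFiniteMeasure ρ] {l : ℂ} (hl : ‖l‖ < 1) :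
    (herglotz ρ l).re = ∫ ζ, poissonK l ζ ∂ρ :=
  (integral_re ((continuous_herglotz_kernel hl).integrable_unitCircle ρ)).symm

lemma differentiableOn_herglotz (ρ : Measure UnitCircle) [IsFiniteMeasure ρ] :
    DifferentiableOn ℂ (herglotz ρ) (Metric.ball 0 1) := by
  intro l hl
  have hl' : ‖l‖ < 1 := by simpa using hl
  set ε := (1 - ‖l‖) / 2 with hε
  have hε0 : 0 < ε := by simp only [hε]; linarith
  have hfar (x : ℂ) (hx : x ∈ Metric.ball l ε) (ζ : UnitCircle) : ε ≤ ‖(ζ : ℂ) - x‖ := by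
    have h1 : ‖x - l‖ < ε := by simpa [dist_eq_norm] using hx
    have h2 := norm_sub_norm_le (ζ : ℂ) x
    have h3 := norm_sub_norm_le x l
    rw [ζ.norm_coe] at h2
    linarith
  have hne (x : ℂ) (hx : x ∈ Metric.ball l ε) (ζ : UnitCircle) : (ζ : ℂ) - x ≠ 0 :=
    norm_pos_iff.1 (hε0.trans_le (hfar x hx ζ))
  have hlε : l ∈ Metric.ball l ε := Metric.mem_ball_self hε0
  have key := hasDerivAt_integral_of_dominated_loc_of_deriv_le (μ := ρ) (𝕜 := ℂ)
    (F := fun x (ζ : UnitCircle) => ((ζ : ℂ) + x) / ((ζ : ℂ) - x))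
    (F' := fun x (ζ : UnitCircle) => 2 * (ζ : ℂ) / ((ζ : ℂ) - x) ^ 2)
    (bound := fun _ => 2 / ε ^ 2) (x₀ := l) (Metric.ball_mem_nhds l hε0) ?_
    ((continuous_herglotz_kernel hl').integrable_unitCircle ρ) ?_ ?_ (integrable_const _) ?_
  · exact key.2.differentiableAt.differentiableWithinAt
  · filter_upwards [Metric.ball_mem_nhds l hε0] with x hx
    exact (Continuous.div (by fun_prop) (by fun_prop)
      (hne x hx)).aestronglyMeasurable_of_compactSpace
  · exact (Continuous.div (by fun_prop) (by fun_prop)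
      fun ζ => pow_ne_zero 2 (hne l hlε ζ)).aestronglyMeasurable_of_compactSpace
  · refine Eventually.of_forall fun ζ x hx => ?_
    have := hfar x hx ζ
    rw [norm_div, norm_mul, norm_pow, ζ.norm_coe, Complex.norm_ofNat, mul_one]
    gcongr
  · refine Eventually.of_forall fun ζ x hx => ?_
    have h1 : HasDerivAt (fun x : ℂ => (ζ : ℂ) + x) 1 x := (hasDerivAt_id x).const_add _
    have h2 : HasDerivAt (fun x : ℂ => (ζ : ℂ) - x) (-1) x := (hasDerivAt_id x).const_sub _
    exact (h1.div h2 (hne x hx ζ)).congr_deriv (by ring)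

/-- The Herglotz transform of a finite measure has radial limits almost everywhere. -/
lemma ae_exists_tendsto_herglotz (ρ : Measure UnitCircle) [IsFiniteMeasure ρ] :
    ∀ᵐ ζ : UnitCircle ∂lebT, ∃ w : ℂ,
      Tendsto (fun r : ℝ => herglotz ρ (r * ζ)) (𝓝[<] 1) (𝓝 w) := by
  have hd := differentiableOn_herglotz ρ
  -- The transform has nonnegative real part, so `exp (-herglotz ρ l)` is bounded and has radial
  -- limits.
  have hb (l : ℂ) (hl : l ∈ Metric.ball (0 : ℂ) 1) : ‖Complex.exp (-herglotz ρ l)‖ ≤ 1 := by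
    have hl' : ‖l‖ < 1 := by simpa using hl
    rw [Complex.norm_exp, Complex.neg_re, re_herglotz ρ hl', Real.exp_le_one_iff]
    have : 0 ≤ ∫ ζ, poissonK l ζ ∂ρ := integral_nonneg fun ζ => (poissonK_pos hl' ζ).le
    linarith
  filter_upwards [ae_exists_tendsto_of_bounded (G := fun l => Complex.exp (-herglotz ρ l))
    (by fun_prop) hb, ae_tendsto_integral_poissonK ρ] with ζ h1 h2
  obtain ⟨c, hc⟩ := h1
  -- By Fatou's theorem the real part has a finite radial limit, so the modulus of the exponential
  -- does not tend to `0`.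
  have hc0 : c ≠ 0 := by
    have h3 : Tendsto (fun r : ℝ => ‖Complex.exp (-herglotz ρ (r * ζ))‖) (𝓝[<] 1)
        (𝓝 (Real.exp (-(2 * Real.pi * (ρ.rnDeriv lebT ζ).toReal)))) := by
      refine ((Real.continuous_exp.tendsto _).comp h2.neg).congr' ?_
      filter_upwards [Ioo_mem_nhdsLT one_pos] with r hr
      rw [Complex.norm_exp, Complex.neg_re, re_herglotz ρ (norm_real_mul_lt_one hr ζ)]
      rfl
    rw [← norm_pos_iff, tendsto_nhds_unique hc.norm h3]
    exact Real.exp_pos _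
  have hcont : ContinuousOn (fun r : ℝ => -herglotz ρ (r * ζ)) (Ioo 0 1) := by
    refine (hd.continuousOn.comp (by fun_prop) fun r hr => ?_).neg
    simpa using norm_real_mul_lt_one hr ζ
  obtain ⟨w, hw⟩ := exists_tendsto_of_tendsto_exp hc0 hcont hc
  exact ⟨-w, by simpa using hw.neg⟩

/-! ### Recovering the order of measures from their Poisson integrals. -/

lemma continuous_poissonK_uncurry {r : ℝ} (hr : r ∈ Ioo (0 : ℝ) 1) :
    Continuous fun q : UnitCircle × UnitCircle => poissonK (r * q.1) q.2 := by
  simp only [poissonK_radial]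
  refine Continuous.div (by fun_prop) (by fun_prop) fun q => ?_
  have h1 := hr.1
  have h2 : 0 < 1 - r := by linarith [hr.2]
  positivity

/-- Integrating the Poisson integral of a function against a measure amounts to integrating the
function against the Poisson integral of the measure. -/
lemma integral_integral_poissonK_mul (ρ : Measure UnitCircle) [IsFiniteMeasure ρ]
    {f : UnitCircle → ℝ} (hf : Continuous f) {r : ℝ} (hr : r ∈ Ioo (0 : ℝ) 1) :
    ∫ w, ∫ ζ, poissonK (r * w) ζ * f ζ ∂lebT ∂ρ = ∫ ζ, f ζ * ∫ w, poissonK (r * ζ) w ∂ρ ∂lebT := by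
  have hc := continuous_poissonK_uncurry hr
  rw [integral_integral_swap]
  · refine integral_congr_ae (Eventually.of_forall fun ζ => ?_)
    simp only [← integral_const_mul]
    refine integral_congr_ae (Eventually.of_forall fun w => ?_)
    simp only [poissonK_comm r w ζ, mul_comm (f ζ)]
  · have : Continuous (Function.uncurry fun w ζ => poissonK (r * (w : UnitCircle)) ζ * f ζ) :=
      hc.mul (hf.comp continuous_snd)
    exact this.integrable_of_hasCompactSupport (HasCompactSupport.of_compactSpace _)

/-- Fubini and the symmetry of the kernel move the Poisson integral onto `f`, where it converges
pointwise and is bounded by `2π sup f`; dominated convergence finishes. -/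
lemma tendsto_integral_integral_poissonK (ρ : Measure UnitCircle) [IsFiniteMeasure ρ]
    {f : UnitCircle → ℝ} (hf : Continuous f) (hf0 : ∀ w, 0 ≤ f w) :
    Tendsto (fun r : ℝ => ∫ ζ, f ζ * ∫ w, poissonK (r * ζ) w ∂ρ ∂lebT) (𝓝[<] 1)
      (𝓝 (2 * Real.pi * ∫ w, f w ∂ρ)) := by
  obtain ⟨C, hC⟩ : ∃ C, ∀ w, f w ≤ C :=
    ⟨_, fun w => (le_abs_self _).trans
      (BoundedContinuousFunction.norm_coe_le_norm (.mkOfCompact ⟨f, hf⟩) w)⟩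
  have hev : ∀ᶠ r in 𝓝[<] (1 : ℝ), r ∈ Ioo (0 : ℝ) 1 := Ioo_mem_nhdsLT one_pos
  have hlim : Tendsto (fun r : ℝ => ∫ w, ∫ ζ, poissonK (r * w) ζ * f ζ ∂lebT ∂ρ) (𝓝[<] 1)
      (𝓝 (∫ w, 2 * Real.pi * f w ∂ρ)) := by
    refine tendsto_integral_filter_of_dominated_convergence (fun _ => 2 * Real.pi * C) ?_ ?_
      (integrable_const _) (Eventually.of_forall fun w => tendsto_integral_poissonK_mul hf hf0 w)
    · filter_upwards [hev] with r hr
      have : Continuous (Function.uncurry fun w ζ => poissonK (r * (w : UnitCircle)) ζ * f ζ) :=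
        (continuous_poissonK_uncurry hr).mul (hf.comp continuous_snd)
      exact this.stronglyMeasurable.integral_prod_right'.aestronglyMeasurable
    · filter_upwards [hev] with r hr
      refine Eventually.of_forall fun w => ?_
      have hl := norm_real_mul_lt_one hr w
      have hK := continuous_poissonK hl
      have h0 : 0 ≤ ∫ ζ, poissonK (r * w) ζ * f ζ ∂lebT :=
        integral_nonneg fun ζ => mul_nonneg (poissonK_pos hl ζ).le (hf0 ζ)
      rw [Real.norm_of_nonneg h0, ← integral_poissonK_lebT hl, ← integral_mul_const]
      refine integral_mono ((hK.mul hf).integrable_unitCircle _)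
        ((hK.mul continuous_const).integrable_unitCircle _) fun ζ => ?_
      exact mul_le_mul_of_nonneg_left (hC ζ) (poissonK_pos hl ζ).le
  rw [integral_const_mul] at hlim
  refine hlim.congr' ?_
  filter_upwards [hev] with r hr using integral_integral_poissonK_mul ρ hf hr

/-- Measures on the circle are ordered as their Poisson integrals are. -/
lemma le_of_integral_poissonK_le {A B : Measure UnitCircle} [IsFiniteMeasure A] [IsFiniteMeasure B]
    (h : ∀ r ∈ Ioo (0 : ℝ) 1, ∀ ζ : UnitCircle,
      ∫ w, poissonK (r * ζ) w ∂A ≤ ∫ w, poissonK (r * ζ) w ∂B) : A ≤ B := by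
  have hcont (ρ : Measure UnitCircle) [IsFiniteMeasure ρ] {r : ℝ} (hr : r ∈ Ioo (0 : ℝ) 1) :
      Integrable (fun ζ : UnitCircle => ∫ w, poissonK (r * ζ) w ∂ρ) lebT :=
    ((continuous_poissonK_uncurry hr).integrable_of_hasCompactSupport
      (HasCompactSupport.of_compactSpace _) (μ := lebT.prod ρ)).integral_prod_left
  have key (f : UnitCircle → ℝ) (hf : Continuous f) (hf0 : ∀ w, 0 ≤ f w) :
      ∫ w, f w ∂A ≤ ∫ w, f w ∂B := by
    have hle := le_of_tendsto_of_tendsto (tendsto_integral_integral_poissonK A hf hf0)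
      (tendsto_integral_integral_poissonK B hf hf0) (by
        filter_upwards [Ioo_mem_nhdsLT one_pos] with r hr
        have hi (ρ : Measure UnitCircle) [IsFiniteMeasure ρ] :
            Integrable (fun ζ : UnitCircle => f ζ * ∫ w, poissonK (r * ζ) w ∂ρ) lebT := by
          refine (hcont ρ hr).bdd_mul (c := ‖BoundedContinuousFunction.mkOfCompact ⟨f, hf⟩‖)
            hf.aestronglyMeasurable_of_compactSpace (Eventually.of_forall fun w =>
              BoundedContinuousFunction.norm_coe_le_norm (.mkOfCompact ⟨f, hf⟩) w)
        exact integral_mono (hi A) (hi B) fun ζ =>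
          mul_le_mul_of_nonneg_left (h r hr ζ) (hf0 ζ))
    exact le_of_mul_le_mul_left hle Real.two_pi_pos
  -- Closed sets are reached by continuous outer approximations, and Borel sets then by inner
  -- regularity.
  have hclosed (F : Set UnitCircle) (hF : IsClosed F) : A F ≤ B F := by
    refine le_of_tendsto_of_tendsto' (HasOuterApproxClosed.tendsto_lintegral_apprSeq hF A)
      (HasOuterApproxClosed.tendsto_lintegral_apprSeq hF B) fun k => ?_
    have hc : Continuous fun x => ((hF.apprSeq k x : NNReal) : ℝ) :=
      NNReal.continuous_coe.comp (hF.apprSeq k).continuous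
    rw [lintegral_coe_eq_integral _ (hc.integrable_unitCircle A),
      lintegral_coe_eq_integral _ (hc.integrable_unitCircle B)]
    exact ENNReal.ofReal_le_ofReal (key _ hc fun w => NNReal.coe_nonneg _)
  refine Measure.le_iff.2 fun E hE => ?_
  rw [hE.measure_eq_iSup_isClosed_of_ne_top (measure_ne_top A E)]
  exact iSup₂_le fun K hK => iSup_le fun hKc => (hclosed K hKc).trans (measure_mono hK)

/-! ### Signed measures as differences of finite positive measures. -/

/-- A functional on bounded measurable functions which is integration against the difference of
two finite measures. -/
def IsMeasureDifference (Φ : (UnitCircle → ℝ) → ℝ) : Prop :=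
  ∃ A B : Measure UnitCircle, IsFiniteMeasure A ∧ IsFiniteMeasure B ∧
    ∀ f : UnitCircle → ℝ, Measurable f → (∃ C, ∀ w, ‖f w‖ ≤ C) →
      Φ f = ∫ w, f w ∂A - ∫ w, f w ∂B

lemma integrable_of_measurable_of_bound {f : UnitCircle → ℝ} (hf : Measurable f)
    (hb : ∃ C, ∀ w, ‖f w‖ ≤ C) (ρ : Measure UnitCircle) [IsFiniteMeasure ρ] : Integrable f ρ :=
  hb.elim fun C hC => .of_bound hf.aestronglyMeasurable C (Eventually.of_forall hC)

lemma isMeasureDifference_integral_mul (ρ : Measure UnitCircle) [IsFiniteMeasure ρ]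
    {u : UnitCircle → ℝ} (hu : Continuous u) :
    IsMeasureDifference fun f => ∫ w, f w * u w ∂ρ := by
  have hui := hu.integrable_unitCircle ρ
  refine ⟨ρ.withDensity fun w => ENNReal.ofReal (u w), ρ.withDensity fun w => ENNReal.ofReal (-u w),
    isFiniteMeasure_withDensity_ofReal hui.2, isFiniteMeasure_withDensity_ofReal hui.neg.2,
    fun f hf hb => ?_⟩
  have hneg' : Measurable fun w => ENNReal.ofReal (-u w) := hu.neg.measurable.ennreal_ofReal
  have hpos : Continuous fun w => max (u w) 0 := by fun_prop
  have hneg : Continuous fun w => max (-u w) 0 := by fun_prop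
  have hi {v : UnitCircle → ℝ} (hv : Continuous v) : Integrable (fun w => v w * f w) ρ :=
    (integrable_of_measurable_of_bound hf hb ρ).bdd_mul
      (c := ‖BoundedContinuousFunction.mkOfCompact ⟨v, hv⟩‖) hv.aestronglyMeasurable_of_compactSpace
      (Eventually.of_forall fun w =>
        BoundedContinuousFunction.norm_coe_le_norm (.mkOfCompact ⟨v, hv⟩) w)
  rw [integral_withDensity_eq_integral_toReal_smul hu.measurable.ennreal_ofReal (by simp),
    integral_withDensity_eq_integral_toReal_smul hneg' (by simp)]
  simp only [ENNReal.toReal_ofReal', smul_eq_mul]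
  rw [← integral_sub (hi hpos) (hi hneg)]
  refine integral_congr_ae (Eventually.of_forall fun w => ?_)
  simp only [← sub_mul, max_zero_sub_max_neg_zero_eq_self, mul_comm (f w)]

lemma IsMeasureDifference.neg {Φ : (UnitCircle → ℝ) → ℝ} (h : IsMeasureDifference Φ) :
    IsMeasureDifference fun f => -Φ f := by
  obtain ⟨A, B, hA, hB, h⟩ := h
  exact ⟨B, A, hB, hA, fun f hf hb => by simp only [h f hf hb, neg_sub]⟩

lemma IsMeasureDifference.add {Φ Ψ : (UnitCircle → ℝ) → ℝ} (h : IsMeasureDifference Φ)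
    (h' : IsMeasureDifference Ψ) : IsMeasureDifference fun f => Φ f + Ψ f := by
  obtain ⟨A, B, hA, hB, h⟩ := h
  obtain ⟨A', B', hA', hB', h'⟩ := h'
  refine ⟨A + A', B + B', inferInstance, inferInstance, fun f hf hb => ?_⟩
  have hi := integrable_of_measurable_of_bound hf hb
  simp only [h f hf hb, h' f hf hb]
  rw [integral_add_measure (hi A) (hi A'),
    integral_add_measure (hi B) (hi B')]
  ring

lemma IsMeasureDifference.sum {ι : Type*} (s : Finset ι) {Φ : ι → (UnitCircle → ℝ) → ℝ}
    (h : ∀ i, IsMeasureDifference (Φ i)) : IsMeasureDifference fun f => ∑ i ∈ s, Φ i f := by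
  classical
  induction s using Finset.induction_on with
  | empty => exact ⟨0, 0, inferInstance, inferInstance, by simp⟩
  | insert i s hi ih =>
    simp only [Finset.sum_insert hi]
    exact (h i).add ih

lemma variation_integrable_toSignedMeasure (ρ : Measure UnitCircle) [IsFiniteMeasure ρ]
    {f : UnitCircle → ℂ} (hf : Continuous f) : ρ.toSignedMeasure.Integrable f := by
  rw [VectorMeasure.Integrable, Measure.variation_toSignedMeasure]
  exact hf.integrable_unitCircle ρ

lemma signedMeasure_eq_sub (μ : SignedMeasure UnitCircle) :
    μ = μ.toJordanDecomposition.posPart.toSignedMeasure -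
      μ.toJordanDecomposition.negPart.toSignedMeasure :=
  (μ.toSignedMeasure_toJordanDecomposition).symm

lemma integral_signedMeasure (μ : SignedMeasure UnitCircle) {f : UnitCircle → ℂ}
    (hf : Continuous f) : ∫ᵛ ζ, f ζ ∂<•μ = ∫ ζ, f ζ ∂μ.toJordanDecomposition.posPart -
      ∫ ζ, f ζ ∂μ.toJordanDecomposition.negPart := by
  conv_lhs => rw [signedMeasure_eq_sub μ]
  rw [VectorMeasure.integral_sub_vectorMeasure (variation_integrable_toSignedMeasure _ hf)
    (variation_integrable_toSignedMeasure _ hf), VectorMeasure.integral_toSignedMeasure,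
    VectorMeasure.integral_toSignedMeasure]

lemma setIntegral_signedMeasure (μ : SignedMeasure UnitCircle) {f : UnitCircle → ℂ}
    (hf : Continuous f) {E : Set UnitCircle} (hE : MeasurableSet E) :
    ∫ᵛ ζ in E, f ζ ∂<•μ = ∫ ζ in E, f ζ ∂μ.toJordanDecomposition.posPart -
      ∫ ζ in E, f ζ ∂μ.toJordanDecomposition.negPart := by
  conv_lhs => rw [signedMeasure_eq_sub μ]
  rw [VectorMeasure.restrict_sub, VectorMeasure.integral_sub_vectorMeasure
    (variation_integrable_toSignedMeasure _ hf).restrict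
    (variation_integrable_toSignedMeasure _ hf).restrict, VectorMeasure.setIntegral_toSignedMeasure hE,
    VectorMeasure.setIntegral_toSignedMeasure hE]

/-- The integral of `f` against `∑ⱼ pⱼ (xⱼ dℒ - dμⱼ)`. -/
noncomputable def pairing {n : ℕ} (p : Fin n → UnitCircle → ℝ)
    (μ : Fin n → SignedMeasure UnitCircle) (x : Fin n → ℝ) (f : UnitCircle → ℝ) : ℝ :=
  ∑ j, (x j * ∫ ζ, f ζ * p j ζ ∂lebT +
    -(∫ ζ, f ζ * p j ζ ∂(μ j).toJordanDecomposition.posPart +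
      -∫ ζ, f ζ * p j ζ ∂(μ j).toJordanDecomposition.negPart))

lemma isMeasureDifference_pairing {n : ℕ} {p : Fin n → UnitCircle → ℝ}
    (hp : ∀ j, Continuous (p j)) (μ : Fin n → SignedMeasure UnitCircle) (x : Fin n → ℝ) :
    IsMeasureDifference (pairing p μ x) := by
  refine IsMeasureDifference.sum _ fun j => IsMeasureDifference.add ?_
    ((isMeasureDifference_integral_mul _ (hp j)).add
      (isMeasureDifference_integral_mul _ (hp j)).neg).neg
  have h := isMeasureDifference_integral_mul lebT ((hp j).const_mul (x j))
  refine (congrArg IsMeasureDifference ?_).mp h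
  ext f
  rw [← integral_const_mul]
  congr 1 with w
  ring

/-- The terms in `μ` cancel: only the absolutely continuous part depends on the base point. -/
lemma pairing_sub_pairing {n : ℕ} (p : Fin n → UnitCircle → ℝ)
    (μ : Fin n → SignedMeasure UnitCircle) (x y : Fin n → ℝ) (f : UnitCircle → ℝ) :
    pairing p μ x f - pairing p μ y f = ∑ j, (x j - y j) * ∫ ζ, f ζ * p j ζ ∂lebT := by
  rw [pairing, pairing, ← Finset.sum_sub_distrib]
  exact Finset.sum_congr rfl fun j _ => by ring

/-- This reduces negativity of the complex measure to a real inequality, tested on indicators. -/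
lemma dotMeasure_apply {n : ℕ} {p : Fin n → UnitCircle → ℝ} (hp : ∀ j, Continuous (p j))
    {v : UnitCircle → Fin n → ℂ} (hv : ∀ ζ j, v ζ j = p j ζ)
    (μ : Fin n → SignedMeasure UnitCircle) (x : Fin n → ℝ) {E : Set UnitCircle}
    (hE : MeasurableSet E) :
    dotMeasure v (fun j => x j • lebT.toSignedMeasure - μ j) E =
      (pairing p μ x (E.indicator 1) : ℝ) := by
  have hpc (j : Fin n) : Continuous fun ζ => (p j ζ : ℂ) := Complex.continuous_ofReal.comp (hp j)
  have hind (ρ : Measure UnitCircle) (j : Fin n) :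
      ∫ ζ, E.indicator (1 : UnitCircle → ℝ) ζ * p j ζ ∂ρ = ∫ ζ in E, p j ζ ∂ρ := by
    rw [← integral_indicator hE]
    congr 1 with ζ
    by_cases h : ζ ∈ E <;> simp [h]
  have hμi (j : Fin n) : (μ j).Integrable fun ζ => (p j ζ : ℂ) := by
    conv_lhs => rw [signedMeasure_eq_sub (μ j)]
    exact (variation_integrable_toSignedMeasure _ (hpc j)).sub_vectorMeasure
      (variation_integrable_toSignedMeasure _ (hpc j))
  have hLi (j : Fin n) : (x j • lebT.toSignedMeasure).Integrable fun ζ => (p j ζ : ℂ) :=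
    (variation_integrable_toSignedMeasure _ (hpc j)).smul_vectorMeasure _
  simp only [dotMeasure, pairing, hv, hind]
  rw [FunLike.coe_sum, Finset.sum_apply, Complex.ofReal_sum]
  refine Finset.sum_congr rfl fun j _ => ?_
  rw [VectorMeasure.withDensity_apply ((hLi j).sub_vectorMeasure (hμi j)),
    VectorMeasure.restrict_sub, VectorMeasure.integral_sub_vectorMeasure (hLi j).restrict
    (hμi j).restrict, setIntegral_signedMeasure (μ j) (hpc j) hE, VectorMeasure.restrict_smul,
    VectorMeasure.integral_smul_vectorMeasure, VectorMeasure.setIntegral_toSignedMeasure hE]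
  simp only [integral_complex_ofReal]
  simp [sub_eq_add_neg]

/-! ### The polynomial `h` and the Poisson integral of the measure in (m). -/

/-- The real trigonometric polynomial `b + 2 Re (ā l)`. -/
noncomputable def trigPoly (a : ℂ) (b : ℝ) (l : ℂ) : ℝ := b + 2 * (conj a * l).re

lemma continuous_trigPoly (a : ℂ) (b : ℝ) : Continuous (trigPoly a b) := by
  unfold trigPoly; fun_prop

lemma conj_mul_eq_trigPoly (a : ℂ) (b : ℝ) (ζ : UnitCircle) :
    conj (ζ : ℂ) * (conj a * ζ ^ 2 + b * ζ + a) = trigPoly a b ζ := by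
  have h := ζ.conj_mul_self
  have h2 : conj a * ζ + a * conj (ζ : ℂ) = ((2 * (conj a * ζ).re : ℝ) : ℂ) := by
    rw [← Complex.add_conj, map_mul, Complex.conj_conj]
  rw [trigPoly, Complex.ofReal_add, ← h2]
  linear_combination (conj a * ζ + b) * h

/-- `trigPoly` is the real part of an affine holomorphic function, so it is its own Poisson
extension. -/
lemma integral_poissonK_mul_trigPoly_lebT (a : ℂ) (b : ℝ) {l : ℂ} (hl : ‖l‖ < 1) :
    ∫ ζ : UnitCircle, poissonK l ζ * trigPoly a b ζ ∂lebT = 2 * Real.pi * trigPoly a b l := by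
  have hf : DiffContOnCl ℂ (fun z => (b : ℂ) + 2 * (conj a * z)) (Metric.ball 0 1) :=
    Differentiable.diffContOnCl (by fun_prop)
  have := integral_poissonK_mul_re hf hl
  simpa [trigPoly] using this

/-- Expanding `(ζ + l)/(ζ - l) · trigPoly a b ζ` leaves the extra term `ā ζ - a ζ̄`, which is purely
imaginary. -/
lemma poissonK_mul_trigPoly (a : ℂ) (b : ℝ) {l : ℂ} (hl : ‖l‖ < 1) (ζ : UnitCircle) :
    poissonK l ζ * trigPoly a b ζ =
      trigPoly a b l + ((conj a * l ^ 2 + b * l + a) * (2 / ((ζ : ℂ) - l))).re := by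
  have hne := ζ.sub_ne_zero hl
  have key : ((ζ : ℂ) + l) / (ζ - l) * trigPoly a b ζ = b + 2 * (conj a * l) +
      (conj a * l ^ 2 + b * l + a) * (2 / ((ζ : ℂ) - l)) + (conj a * ζ - a * conj (ζ : ℂ)) := by
    rw [← conj_mul_eq_trigPoly]
    field_simp
    linear_combination (conj a * ζ ^ 2 + conj a * ζ * l + b * ζ + b * l + 2 * a) * ζ.conj_mul_self
  have h := congrArg Complex.re key
  have h2 : (conj a * ζ - a * conj (ζ : ℂ)).re = 0 := by
    have := congrArg Complex.re (Complex.sub_conj (conj a * ζ))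
    simpa only [map_mul, Complex.conj_conj, Complex.mul_I_re, Complex.ofReal_im, neg_zero] using this
  rw [Complex.add_re, h2, add_zero, Complex.re_mul_ofReal] at h
  rw [poissonK, h]
  simp [trigPoly]

lemma herglotz_sub (ρ : Measure UnitCircle) [IsFiniteMeasure ρ] {l : ℂ} (hl : ‖l‖ < 1) :
    herglotz ρ l - ρ.real univ = l * ∫ ζ : UnitCircle, 2 / ((ζ : ℂ) - l) ∂ρ := by
  have h : ((ρ.real univ : ℝ) : ℂ) = ∫ _ : UnitCircle, (1 : ℂ) ∂ρ := by simp
  rw [h, herglotz, ← integral_sub ((continuous_herglotz_kernel hl).integrable_unitCircle ρ)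
    (integrable_const _), ← integral_const_mul]
  congr 1 with ζ
  have := ζ.sub_ne_zero hl
  field_simp
  ring

lemma integral_poissonK_mul_trigPoly (ρ : Measure UnitCircle) [IsFiniteMeasure ρ] (a : ℂ) (b : ℝ)
    {l : ℂ} (hl : ‖l‖ < 1) (hl0 : l ≠ 0) :
    ∫ ζ : UnitCircle, poissonK l ζ * trigPoly a b ζ ∂ρ = trigPoly a b l * ρ.real univ +
      ((conj a * l ^ 2 + b * l + a) * (l⁻¹ * (herglotz ρ l - ρ.real univ))).re := by
  have hc : Continuous fun ζ : UnitCircle => 2 / ((ζ : ℂ) - l) :=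
    Continuous.div (by fun_prop) (by fun_prop) fun ζ => ζ.sub_ne_zero hl
  have hi := (hc.const_mul (conj a * l ^ 2 + b * l + a)).integrable_unitCircle ρ
  have hre := integral_re hi
  simp only [RCLike.re_to_complex] at hre
  have hi' : Integrable (fun ζ : UnitCircle =>
    ((conj a * l ^ 2 + b * l + a) * (2 / ((ζ : ℂ) - l))).re) ρ := hi.re
  simp only [poissonK_mul_trigPoly a b hl]
  rw [integral_add (integrable_const _) hi', herglotz_sub ρ hl, inv_mul_cancel_left₀ hl0,
    ← integral_const_mul, hre]
  simp [mul_comm]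

lemma herglotz_zero (ρ : Measure UnitCircle) [IsFiniteMeasure ρ] : herglotz ρ 0 = ρ.real univ := by
  have := herglotz_sub ρ (l := 0) (by simp)
  rwa [zero_mul, sub_eq_zero] at this

lemma IsBoundaryMeasure.exists_eq_herglotz {n : ℕ} {φ : ℂ → Fin n → ℂ}
    {μ : Fin n → SignedMeasure UnitCircle} (hμ : IsBoundaryMeasure φ μ) (j : Fin n) :
    ∃ α : ℝ, ∀ l : ℂ, ‖l‖ < 1 → φ l j = 1 / (2 * (Real.pi : ℂ)) *
      (herglotz (μ j).toJordanDecomposition.posPart l -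
        herglotz (μ j).toJordanDecomposition.negPart l) + Complex.I * α := by
  obtain ⟨α, hα⟩ := hμ j
  refine ⟨α, fun l hl => ?_⟩
  rw [hα l (by simpa using hl), integral_signedMeasure _ (continuous_herglotz_kernel hl)]
  rfl

lemma IsBoundaryMeasure.ae_exists_isRadialLimit {n : ℕ} {φ : ℂ → Fin n → ℂ}
    {μ : Fin n → SignedMeasure UnitCircle} (hμ : IsBoundaryMeasure φ μ) :
    ∀ᵐ ζ ∂lebT, ∃ w, IsRadialLimit φ ζ w := by
  have h (j : Fin n) : ∀ᵐ ζ : UnitCircle ∂lebT, ∃ w : ℂ,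
      Tendsto (fun r : ℝ => φ (r * ζ) j) (𝓝[<] 1) (𝓝 w) := by
    obtain ⟨α, hα⟩ := hμ.exists_eq_herglotz j
    filter_upwards [ae_exists_tendsto_herglotz (μ j).toJordanDecomposition.posPart,
      ae_exists_tendsto_herglotz (μ j).toJordanDecomposition.negPart] with ζ h1 h2
    obtain ⟨w1, h1⟩ := h1
    obtain ⟨w2, h2⟩ := h2
    refine ⟨_, (((h1.sub h2).const_mul (1 / (2 * (Real.pi : ℂ)))).add_const
      (Complex.I * α)).congr' ?_⟩
    filter_upwards [Ioo_mem_nhdsLT one_pos] with r hr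
    exact (hα _ (norm_real_mul_lt_one hr ζ)).symm
  filter_upwards [ae_all_iff.2 h] with ζ hζ
  choose w hw using hζ
  exact ⟨w, tendsto_pi_nhds.2 hw⟩

lemma pairing_poissonK_sub {n : ℕ} (a : Fin n → ℂ) (b : Fin n → ℝ)
    (μ : Fin n → SignedMeasure UnitCircle) (x y : Fin n → ℝ) {l : ℂ} (hl : ‖l‖ < 1) :
    pairing (fun j ζ => trigPoly (a j) (b j) ζ) μ x (poissonK l) -
      pairing (fun j ζ => trigPoly (a j) (b j) ζ) μ y (poissonK l) =
      2 * Real.pi * ∑ j, (x j - y j) * trigPoly (a j) (b j) l := by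
  rw [pairing_sub_pairing, Finset.mul_sum]
  refine Finset.sum_congr rfl fun j _ => ?_
  rw [integral_poissonK_mul_trigPoly_lebT _ _ hl]
  ring

/-- Since `2π Re φ_j(0)` is the total mass of `μ_j`, the multiples of `trigPoly` at `l` cancel. What
remains is the difference quotient of the Herglotz transforms. -/
lemma two_pi_mul_re_dotProduct_eq_pairing {n : ℕ} {φ : ℂ → Fin n → ℂ}
    {μ : Fin n → SignedMeasure UnitCircle} (hμ : IsBoundaryMeasure φ μ)
    {a : Fin n → ℂ} {b : Fin n → ℝ} {h : ℂ → Fin n → ℂ}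
    (hh : ∀ l j, h l j = conj (a j) * l ^ 2 + (b j : ℂ) * l + a j) {l : ℂ} (hl : ‖l‖ < 1)
    (hl0 : l ≠ 0) :
    2 * Real.pi * (h l ⬝ᵥ (l⁻¹ • (φ 0 - φ l))).re =
      pairing (fun j ζ => trigPoly (a j) (b j) ζ) μ (fun j => (φ 0 j).re) (poissonK l) := by
  rw [dotProduct, Complex.re_sum, Finset.mul_sum, pairing]
  refine Finset.sum_congr rfl fun j _ => ?_
  obtain ⟨α, hα⟩ := hμ.exists_eq_herglotz j
  have hπ : (Real.pi : ℂ) ≠ 0 := Complex.ofReal_ne_zero.2 Real.pi_ne_zero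
  rw [integral_poissonK_mul_trigPoly_lebT _ _ hl, integral_poissonK_mul_trigPoly _ _ _ hl hl0,
    integral_poissonK_mul_trigPoly _ _ _ hl hl0, hh, Pi.smul_apply, Pi.sub_apply, smul_eq_mul]
  set P := (μ j).toJordanDecomposition.posPart
  set N := (μ j).toJordanDecomposition.negPart
  have h0 := hα 0 (by simp)
  rw [herglotz_zero, herglotz_zero] at h0
  have hre : 2 * Real.pi * (φ 0 j).re = P.real univ - N.real univ := by
    have e : (2 * Real.pi : ℂ) * φ 0 j =
        ((P.real univ - N.real univ : ℝ) : ℂ) + ((2 * Real.pi * α : ℝ) : ℂ) * Complex.I := by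
      rw [h0]; push_cast; field_simp
    have := congrArg Complex.re e
    simpa using this
  set c := conj (a j) * l ^ 2 + (b j : ℂ) * l + a j
  have e : (2 * Real.pi : ℂ) * (c * (l⁻¹ * (φ 0 j - φ l j))) =
      c * (l⁻¹ * (herglotz N l - N.real univ)) - c * (l⁻¹ * (herglotz P l - P.real univ)) := by
    rw [hα l hl, h0]; field_simp; ring
  have e' := congrArg Complex.re e
  rw [Complex.sub_re, show (2 * Real.pi : ℂ) = ((2 * Real.pi : ℝ) : ℂ) by push_cast; rfl,
    Complex.re_ofReal_mul] at e'
  linear_combination e' - trigPoly (a j) (b j) l * hre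

lemma re_conj_mul_dotProduct {n : ℕ} {a : Fin n → ℂ} {b : Fin n → ℝ} {h : ℂ → Fin n → ℂ}
    (hh : ∀ l j, h l j = conj (a j) * l ^ 2 + (b j : ℂ) * l + a j) (ζ : UnitCircle)
    (u : Fin n → ℂ) :
    (conj (ζ : ℂ) * (h ζ ⬝ᵥ u)).re = ∑ j, trigPoly (a j) (b j) ζ * (u j).re := by
  rw [dotProduct, Finset.mul_sum, Complex.re_sum]
  refine Finset.sum_congr rfl fun j _ => ?_
  rw [← mul_assoc, hh, conj_mul_eq_trigPoly, Complex.re_ofReal_mul]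

lemma IsRadialLimit.tendsto_re_dotProduct {n : ℕ} {φ : ℂ → Fin n → ℂ} {ζ : UnitCircle}
    {w : Fin n → ℂ} (hw : IsRadialLimit φ ζ w) {a : Fin n → ℂ} {b : Fin n → ℝ}
    {h : ℂ → Fin n → ℂ} (hh : ∀ l j, h l j = conj (a j) * l ^ 2 + (b j : ℂ) * l + a j) :
    Tendsto (fun r : ℝ => (h (r * ζ) ⬝ᵥ (((r : ℂ) * ζ)⁻¹ • (φ 0 - φ (r * ζ)))).re) (𝓝[<] 1)
      (𝓝 (∑ j, trigPoly (a j) (b j) ζ * (φ 0 j - w j).re)) := by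
  have hr : Tendsto (fun r : ℝ => (r : ℂ) * ζ) (𝓝[<] 1) (𝓝 ζ) := by
    have : Continuous fun r : ℝ => (r : ℂ) * ζ := by fun_prop
    simpa using (this.tendsto 1).mono_left (nhdsWithin_le_nhds (s := Iio 1))
  have hhc (j : Fin n) : Continuous fun l => h l j := by
    simp only [hh]; fun_prop
  have key := re_conj_mul_dotProduct hh ζ (φ 0 - w)
  simp only [Pi.sub_apply] at key
  rw [← key, dotProduct, Finset.mul_sum]
  refine (Complex.continuous_re.tendsto _).comp (tendsto_finsetSum _ fun j _ => ?_)
  have h1 := ((hhc j).tendsto _).comp hr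
  have h2 := hr.inv₀ ζ.ne_zero
  have h3 := (tendsto_pi_nhds.1 hw j).const_sub (φ 0 j)
  rw [ζ.inv_eq_conj] at h2
  have h4 := h1.mul (h2.mul h3)
  rw [mul_left_comm] at h4
  exact h4

/-! ### Perturbation inside the tube and nondegeneracy of `h`. -/

lemma IsConvexTube.exists_sum_pos {n : ℕ} {D : Set (Fin n → ℂ)} (hD : IsConvexTube D)
    {z : Fin n → ℂ} (hz : z ∈ D) {q : Fin n → ℝ} (hq : q ≠ 0) :
    ∃ z' ∈ D, 0 < ∑ j, q j * ((z' j).re - (z j).re) := by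
  obtain ⟨Ω, hΩ, -, -, rfl⟩ := hD
  have hc : Continuous fun t : ℝ => fun j => (z j).re + t * q j := by fun_prop
  have h0 : ∀ᶠ t in 𝓝[>] (0 : ℝ), (fun j => (z j).re + t * q j) ∈ Ω := by
    refine (hc.tendsto 0).mono_left nhdsWithin_le_nhds |>.eventually (hΩ.mem_nhds ?_)
    simpa using hz
  obtain ⟨t, ht, ht0⟩ := (h0.and self_mem_nhdsWithin).exists
  refine ⟨fun j => z j + t * q j, by simpa using ht, ?_⟩
  have ht0' : 0 < t := ht0
  obtain ⟨i, hi⟩ := Function.ne_iff.1 hq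
  have hi' : q i ≠ 0 := hi
  refine Finset.sum_pos' (fun j _ => ?_) ⟨i, Finset.mem_univ i, ?_⟩
  · simp only [Complex.add_re, Complex.re_ofReal_mul, Complex.ofReal_re, add_sub_cancel_left]
    nlinarith [mul_nonneg ht0'.le (mul_self_nonneg (q j))]
  · simp only [Complex.add_re, Complex.re_ofReal_mul, Complex.ofReal_re, add_sub_cancel_left]
    nlinarith [mul_pos ht0' (mul_self_pos.2 hi')]

/-- The values at `0`, `1/2` and `i/2` are `b`, `b + Re a` and `b + Im a`. -/
lemma coeff_eq_zero_of_trigPoly_eq_zero {a : ℂ} {b : ℝ}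
    (h : ∀ l : ℂ, ‖l‖ < 1 → trigPoly a b l = 0) : a = 0 ∧ b = 0 := by
  have h0 := h 0 (by simp)
  have h1 := h (1 / 2) (by norm_num)
  have h2 := h (Complex.I / 2) (by norm_num)
  have hb : b = 0 := by simpa [trigPoly] using h0
  subst hb
  simp [trigPoly, Complex.mul_re] at h1 h2
  exact ⟨Complex.ext h1 h2, rfl⟩

/-- Some component of `h` is a nonzero polynomial, with finitely many zeros, and arc length has no
atoms. -/
lemma ae_trigPoly_ne_zero {n : ℕ} {a : Fin n → ℂ} {b : Fin n → ℝ} {h : ℂ → Fin n → ℂ}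
    (hh : ∀ l j, h l j = conj (a j) * l ^ 2 + (b j : ℂ) * l + a j) (hne : h ≠ 0) :
    ∀ᵐ ζ : UnitCircle ∂lebT, (fun j => trigPoly (a j) (b j) ζ) ≠ 0 := by
  obtain ⟨l, hl⟩ := Function.ne_iff.1 hne
  obtain ⟨j, hj⟩ := Function.ne_iff.1 hl
  let q : Polynomial ℂ := .C (conj (a j)) * .X ^ 2 + .C (b j : ℂ) * .X + .C (a j)
  have hq (l : ℂ) : q.eval l = h l j := by simp [q, hh]
  have hq0 : q ≠ 0 := by
    intro h0
    apply hj
    rw [← hq, h0]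
    simp
  have hfin : {ζ : UnitCircle | trigPoly (a j) (b j) ζ = 0}.Finite := by
    refine (Set.Finite.preimage Subtype.val_injective.injOn
      (Polynomial.finite_setOfPred_isRoot hq0)).subset fun ζ hζ => ?_
    have h1 := conj_mul_eq_trigPoly (a j) (b j) ζ
    rw [show trigPoly (a j) (b j) ζ = 0 from hζ, ← hh, Complex.ofReal_zero] at h1
    have h2 : conj (ζ : ℂ) ≠ 0 := by rw [← UnitCircle.inv_eq_conj ζ]; exact inv_ne_zero (UnitCircle.ne_zero ζ)
    show q.eval (ζ : ℂ) = 0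
    rw [hq]
    exact (mul_eq_zero.1 h1).resolve_left h2
  filter_upwards [hfin.measure_zero lebT |> measure_eq_zero_iff_ae_notMem.1] with ζ hζ h0
  exact hζ (congrFun h0 j)

/-! ### Negative measures and the sign of their Poisson integrals. -/

lemma bounded_poissonK {l : ℂ} (hl : ‖l‖ < 1) : ∃ C, ∀ w, ‖poissonK l w‖ ≤ C :=
  ⟨_, BoundedContinuousFunction.norm_coe_le_norm (.mkOfCompact ⟨_, continuous_poissonK hl⟩)⟩

lemma bounded_indicator_one (E : Set UnitCircle) :
    ∃ C, ∀ w, ‖E.indicator (1 : UnitCircle → ℝ) w‖ ≤ C :=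
  ⟨1, fun w => by by_cases h : w ∈ E <;> simp [h]⟩

lemma measurable_indicator_one {E : Set UnitCircle} (hE : MeasurableSet E) :
    Measurable (E.indicator (1 : UnitCircle → ℝ)) := measurable_one.indicator hE

lemma le_of_forall_indicator_nonpos {Φ : (UnitCircle → ℝ) → ℝ} {A B : Measure UnitCircle}
    [IsFiniteMeasure A] [IsFiniteMeasure B]
    (h : ∀ f : UnitCircle → ℝ, Measurable f → (∃ C, ∀ w, ‖f w‖ ≤ C) →
      Φ f = ∫ w, f w ∂A - ∫ w, f w ∂B)
    (hΦ : ∀ E, MeasurableSet E → Φ (E.indicator 1) ≤ 0) : A ≤ B := by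
  refine Measure.le_iff.2 fun E hE => ?_
  have h1 := hΦ E hE
  rw [h _ (measurable_indicator_one hE) (bounded_indicator_one E), integral_indicator_one hE,
    integral_indicator_one hE, sub_nonpos, Measure.real, Measure.real,
    ENNReal.toReal_le_toReal (measure_ne_top _ _) (measure_ne_top _ _)] at h1
  exact h1

/-- A difference of measures which is negative on sets has a negative Poisson integral. -/
lemma IsMeasureDifference.poissonK_nonpos {Φ : (UnitCircle → ℝ) → ℝ} (h : IsMeasureDifference Φ)
    (hΦ : ∀ E, MeasurableSet E → Φ (E.indicator 1) ≤ 0) {l : ℂ} (hl : ‖l‖ < 1) :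
    Φ (poissonK l) ≤ 0 := by
  obtain ⟨A, B, hA, hB, h⟩ := h
  have hc := continuous_poissonK hl
  rw [h _ hc.measurable (bounded_poissonK hl), sub_nonpos]
  exact integral_mono_measure (le_of_forall_indicator_nonpos h hΦ)
    (Eventually.of_forall fun w => (poissonK_pos hl w).le) (hc.integrable_unitCircle B)

/-- A negative Poisson integral vanishing at one point vanishes identically. -/
lemma IsMeasureDifference.poissonK_eq_zero {Φ : (UnitCircle → ℝ) → ℝ} (h : IsMeasureDifference Φ)
    (hΦ : ∀ E, MeasurableSet E → Φ (E.indicator 1) ≤ 0) {l : ℂ} (hl : ‖l‖ < 1)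
    (h0 : Φ (poissonK l) = 0) {l' : ℂ} (hl' : ‖l'‖ < 1) : Φ (poissonK l') = 0 := by
  obtain ⟨A, B, hA, hB, h⟩ := h
  have hAB := le_of_forall_indicator_nonpos h hΦ
  have hc := continuous_poissonK hl
  have hsum : B - A + A = B := Measure.sub_add_cancel_of_le hAB
  rw [h _ hc.measurable (bounded_poissonK hl), ← hsum,
    integral_add_measure (hc.integrable_unitCircle _) (hc.integrable_unitCircle _)] at h0
  have h1 : ∫ w, poissonK l w ∂(B - A) = 0 := by linarith
  rw [integral_eq_zero_iff_of_nonneg (fun w => (poissonK_pos hl w).le)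
    (hc.integrable_unitCircle _)] at h1
  -- A strictly positive kernel with zero integral leaves no mass.
  have h2 : B - A = 0 := by
    rw [← ae_eq_bot, ← eventually_false_iff_eq_bot]
    filter_upwards [h1] with w hw using (poissonK_pos hl w).ne' hw
  rw [h2, zero_add] at hsum
  rw [h _ (continuous_poissonK hl').measurable (bounded_poissonK hl'), hsum, sub_self]

end ConvexTube

/-! ### The equivalence. -/

open ConvexTube in
theorem mainTheorem4 {n : ℕ} (D : Set (Fin n → ℂ))
    (hD : ConvexTube.IsConvexTube D) (hDtaut : ConvexTube.IsTaut D)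
    (φ : ℂ → Fin n → ℂ) (hφ : ConvexTube.IsHolDisc φ D)
    (μ : Fin n → SignedMeasure ConvexTube.UnitCircle) (hμ : ConvexTube.IsBoundaryMeasure φ μ)
    (a : Fin n → ℂ) (b : Fin n → ℝ) (h : ℂ → Fin n → ℂ)
    (hh : ∀ l j, h l j = conj (a j) * l ^ 2 + (b j : ℂ) * l + a j) (hne : h ≠ 0) :
    (∀ z ∈ D, ConvexTube.IsNegativeMeasure
        (ConvexTube.dotMeasure (fun ζ => conj (ζ : ℂ) • h ζ)
          (fun j => (z j).re • ConvexTube.lebT.toSignedMeasure - μ j))) ↔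
      ((∀ᵐ ζ ∂ConvexTube.lebT, ∃ w : Fin n → ℂ, ConvexTube.IsRadialLimit φ ζ w ∧
          ∀ z ∈ D, (conj (ζ : ℂ) * (h ζ ⬝ᵥ (z - w))).re < 0) ∧
        (∀ l ∈ Metric.ball (0 : ℂ) 1, l ≠ 0 →
          (h l ⬝ᵥ (l⁻¹ • (φ 0 - φ l))).re < 0)) := by
  have hπ := Real.two_pi_pos
  have hφ0 : φ 0 ∈ D := hφ.2 (by simp)
  set p : Fin n → UnitCircle → ℝ := fun j ζ => trigPoly (a j) (b j) ζ with hp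
  have hpc (j : Fin n) : Continuous (p j) :=
    (continuous_trigPoly (a j) (b j)).comp continuous_subtype_val
  have hdiff := isMeasureDifference_pairing hpc μ
  have hneg (z : Fin n → ℂ) : IsNegativeMeasure (dotMeasure (fun ζ => conj (ζ : ℂ) • h ζ)
      (fun j => (z j).re • lebT.toSignedMeasure - μ j)) ↔
      ∀ E, MeasurableSet E → pairing p μ (fun j => (z j).re) (E.indicator 1) ≤ 0 := by
    refine forall₂_congr fun E hE => ?_
    rw [dotMeasure_apply hpc (fun ζ j => ?_) μ _ hE]
    · simp
    · rw [Pi.smul_apply, smul_eq_mul, hh, conj_mul_eq_trigPoly]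
  have hF {l : ℂ} (hl : ‖l‖ < 1) (hl0 : l ≠ 0) :=
    two_pi_mul_re_dotProduct_eq_pairing hμ hh hl hl0
  simp only [hneg]
  constructor
  · intro hm
    have hQ (z : Fin n → ℂ) (hz : z ∈ D) {l : ℂ} (hl : ‖l‖ < 1) :=
      (hdiff fun j => (z j).re).poissonK_nonpos (hm z hz) hl
    have hsub (z : Fin n → ℂ) {l : ℂ} (hl : ‖l‖ < 1) :=
      pairing_poissonK_sub a b μ (fun j => (z j).re) (fun j => (φ 0 j).re) hl
    constructor
    · filter_upwards [hμ.ae_exists_isRadialLimit, ae_trigPoly_ne_zero hh hne] with ζ hw hζ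
      obtain ⟨w, hw⟩ := hw
      refine ⟨w, hw, fun z hz => ?_⟩
      -- The weak form of (i): the radial limit of the nonpositive Poisson integral of `ν_z`.
      have hle (z : Fin n → ℂ) (hz : z ∈ D) :
          ∑ j, trigPoly (a j) (b j) ζ * (z j - w j).re ≤ 0 := by
        have hc : Continuous fun r : ℝ =>
            ∑ j, ((z j).re - (φ 0 j).re) * trigPoly (a j) (b j) (r * ζ) :=
          continuous_finsetSum _ fun j _ => continuous_const.mul
            ((continuous_trigPoly _ _).comp (by fun_prop))
        have h1 := (hw.tendsto_re_dotProduct hh).add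
          ((hc.tendsto 1).mono_left (nhdsWithin_le_nhds (s := Iio 1)))
        have h2 := le_of_tendsto h1 (b := 0) (by
          filter_upwards [Ioo_mem_nhdsLT one_pos] with r hr
          have hl := norm_real_mul_lt_one hr ζ
          have hl0 : (r : ℂ) * ζ ≠ 0 :=
            mul_ne_zero (Complex.ofReal_ne_zero.2 hr.1.ne') (UnitCircle.ne_zero ζ)
          refine nonpos_of_mul_nonpos_right ?_ hπ
          rw [mul_add, hF hl hl0, ← hsub z hl]
          linarith [hQ z hz hl])
        refine le_of_eq_of_le ?_ h2
        rw [← Finset.sum_add_distrib]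
        refine Finset.sum_congr rfl fun j _ => ?_
        simp only [Complex.ofReal_one, one_mul, Complex.sub_re]
        ring
      -- Strictness: moving `z` in the direction `p(ζ)` increases the left side, which is still at
      -- most `0` at `z'`.
      obtain ⟨z', hz', hpos⟩ := hD.exists_sum_pos hz hζ
      rw [re_conj_mul_dotProduct hh]
      refine lt_of_lt_of_le ?_ (hle z' hz')
      rw [← sub_pos, ← Finset.sum_sub_distrib]
      refine lt_of_lt_of_eq hpos (Finset.sum_congr rfl fun j _ => ?_)
      simp only [Pi.sub_apply, Complex.sub_re]
      ring
    · intro l hl hl0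
      have hl' : ‖l‖ < 1 := by simpa using hl
      have hle := hQ _ hφ0 hl'
      rw [← hF hl' hl0] at hle
      -- In the equality case the Poisson integral for `φ 0` vanishes identically. The one for `z'`
      -- is then linear in `Re z' - Re φ(0)`, and it cannot stay nonpositive on an open set unless
      -- the coefficients vanish.
      refine (nonpos_of_mul_nonpos_right hle hπ).lt_of_ne fun h0 => hne ?_
      have hz0 {l' : ℂ} (hl' : ‖l'‖ < 1) :=
        (hdiff fun j => (φ 0 j).re).poissonK_eq_zero (hm _ hφ0) (l := l) (by simpa using hl)
          (by rw [← hF (by simpa using hl) hl0, h0, mul_zero]) hl'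
      have hzero (l' : ℂ) (hl' : ‖l'‖ < 1) : (fun j => trigPoly (a j) (b j) l') = 0 := by
        by_contra hcon
        obtain ⟨z', hz', hpos⟩ := hD.exists_sum_pos hφ0 hcon
        have h1 := hsub z' hl'
        rw [hz0 hl', sub_zero] at h1
        have h2 := hQ z' hz' hl'
        rw [h1] at h2
        have h3 := nonpos_of_mul_nonpos_right h2 hπ
        simp only [mul_comm ((z' _).re - _)] at h3
        linarith
      ext l' j
      obtain ⟨ha, hb⟩ := coeff_eq_zero_of_trigPoly_eq_zero fun l' hl' => congrFun (hzero l' hl') j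
      simp [hh, ha, hb]
  · rintro ⟨hi, hii⟩ z hz E hE
    obtain ⟨A, B, hA, hB, hAB⟩ := hdiff fun j => (φ 0 j).re
    have hpair {r : ℝ} (hr : r ∈ Ioo (0 : ℝ) 1) (ζ : UnitCircle) :
        2 * Real.pi * (h (r * ζ) ⬝ᵥ (((r : ℂ) * ζ)⁻¹ • (φ 0 - φ (r * ζ)))).re =
          ∫ w, poissonK (r * ζ) w ∂A - ∫ w, poissonK (r * ζ) w ∂B := by
      have hl := norm_real_mul_lt_one hr ζ
      rw [← hAB _ (continuous_poissonK hl).measurable (bounded_poissonK hl)]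
      exact hF hl (mul_ne_zero (Complex.ofReal_ne_zero.2 hr.1.ne') ζ.ne_zero)
    have hle : A ≤ B := le_of_integral_poissonK_le fun r hr ζ => by
      have h1 := hii (r * ζ) (by simpa using norm_real_mul_lt_one hr ζ)
        (mul_ne_zero (Complex.ofReal_ne_zero.2 hr.1.ne') ζ.ne_zero)
      have h2 := hpair hr ζ
      have h3 := mul_neg_of_pos_of_neg hπ h1
      linarith
    have hsum : B - A + A = B := Measure.sub_add_cancel_of_le hle
    -- `B - A` is `-ν_{φ(0)}`. Fatou's theorem expresses its density through `φ*(ζ)`, and (i) at `z`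
    -- becomes this bound.
    have hdens : ∀ᵐ ζ ∂lebT, ∑ j, ((z j).re - (φ 0 j).re) * p j ζ ≤
        ((B - A).rnDeriv lebT ζ).toReal := by
      filter_upwards [hi, ae_tendsto_integral_poissonK (B - A)] with ζ hw hlim
      obtain ⟨w, hw, hlt⟩ := hw
      have h1 := (hw.tendsto_re_dotProduct hh).const_mul (-(2 * Real.pi))
      have h2 := tendsto_nhds_unique hlim (h1.congr' (by
        filter_upwards [Ioo_mem_nhdsLT one_pos] with r hr
        have hc := continuous_poissonK (norm_real_mul_lt_one hr ζ)
        have h3 := hpair hr ζ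
        rw [← hsum, integral_add_measure (hc.integrable_unitCircle _)
          (hc.integrable_unitCircle _)] at h3
        linarith))
      have h3 := hlt z hz
      rw [re_conj_mul_dotProduct hh] at h3
      have h4 : ((B - A).rnDeriv lebT ζ).toReal =
          -∑ j, trigPoly (a j) (b j) ζ * (φ 0 j - w j).re := by
        refine mul_left_cancel₀ hπ.ne' ?_
        rw [h2]; ring
      have h5 : ∑ j, trigPoly (a j) (b j) ζ * ((z - w) j).re =
          ∑ j, ((z j).re - (φ 0 j).re) * p j ζ +
            ∑ j, trigPoly (a j) (b j) ζ * (φ 0 j - w j).re := by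
        rw [← Finset.sum_add_distrib]
        refine Finset.sum_congr rfl fun j _ => ?_
        simp only [hp, Pi.sub_apply, Complex.sub_re]
        ring
      linarith
    have h1 := pairing_sub_pairing p μ (fun j => (z j).re) (fun j => (φ 0 j).re) (E.indicator 1)
    have h2 : ∑ j, ((z j).re - (φ 0 j).re) * ∫ ζ, E.indicator (1 : UnitCircle → ℝ) ζ * p j ζ ∂lebT =
        ∫ ζ in E, ∑ j, ((z j).re - (φ 0 j).re) * p j ζ ∂lebT := by
      rw [integral_finsetSum _ fun j _ =>
        ((hpc j).const_mul _).integrable_unitCircle (lebT.restrict E)]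
      refine Finset.sum_congr rfl fun j _ => ?_
      rw [integral_const_mul, ← integral_indicator hE]
      congr 2 with ζ
      by_cases hζ : ζ ∈ E <;> simp [hζ]
    -- The singular part of `B - A` is nonnegative and is simply dropped.
    have h3 : ∫ ζ in E, ∑ j, ((z j).re - (φ 0 j).re) * p j ζ ∂lebT ≤ (B - A).real E := by
      refine (integral_mono_ae ?_ Measure.integrable_toReal_rnDeriv.integrableOn
        (ae_restrict_of_ae hdens)).trans (Measure.setIntegral_toReal_rnDeriv_le (measure_ne_top _ _))
      exact (continuous_finsetSum _ fun j _ => (hpc j).const_mul _).integrable_unitCircle _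
    have h4 := hAB _ (measurable_indicator_one hE) (bounded_indicator_one E)
    rw [integral_indicator_one hE, integral_indicator_one hE] at h4
    have h5 : B.real E = (B - A).real E + A.real E := by
      conv_lhs => rw [← hsum]
      exact measureReal_add_apply
    linarith
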